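/- Let $X_0,X_1,X_2,\dots$ be independent real random variables on a common probability space with $E(X_j)=0$, $E(X_j^2)=1$ and $\sup_j E|X_j|^3<\infty$. For $n\ge 1$, let $R_n$ be the $n\times n$ (symmetric) reverse circulant matrix with first row $X_0,X_1,\dots,X_{n-1}$, that is, $(R_n)_{i,j}=X_{(i+j)\bmod n}$ for $0\le i,j\le n-1$, and let $C_n$ be the $n\times n$ symmetric circulant matrix with first row $X_0,X_1,X_2,\dots,X_2,X_1$, that is, $(C_n)_{i,j}=X_{\min(d,\,n-d)}$ with $d=(i-j)\bmod n$. The spectral distribution of a real symmetric $n\times n$ matrix is the probability measure $\frac1n\sum_{i=1}^n\delta_{\lambda_i}$, where $\lambda_1,\dots,\lambda_n$ are its eigenvalues, counted with multiplicity. Then, as $n\to\infty$: 1. with probability one, the spectral distribution of $n^{-1/2}R_n$ converges weakly to the probability law on $\mathbb R$ with density $|x|e^{-x^2}$; 2. with probability one, the spectral distribution of $n^{-1/2}C_n$ converges weakly to the standard normal law $N(0,1)$. -/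

import Mathlib

open MeasureTheory ProbabilityTheory Filter Topology

noncomputable section

/-- The `n × n` reverse circulant matrix with first row `x 0, x 1, …, x (n - 1)`: each row is
the left circular shift of the preceding one. -/
def reverseCirculant (n : ℕ) (x : ℕ → ℝ) : Matrix (Fin n) (Fin n) ℝ :=
  Matrix.of fun i j => x (((i : ℕ) + (j : ℕ)) % n)

/-- The `n × n` symmetric circulant matrix with first row `x 0, x 1, x 2, …, x 2, x 1`:
the entry in position `d` of the first row is `x (min d (n - d))`. -/
def symmetricCirculant (n : ℕ) (x : ℕ → ℝ) : Matrix (Fin n) (Fin n) ℝ :=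
  Matrix.circulant fun d : Fin n => x (min (d : ℕ) (n - (d : ℕ)))

theorem reverseCirculant_isHermitian (n : ℕ) (x : ℕ → ℝ) :
    (((√(n : ℝ))⁻¹) • reverseCirculant n x).IsHermitian := by
  ext i j
  simp [reverseCirculant, Matrix.conjTranspose_apply, add_comm]

theorem symmetricCirculant_isHermitian (n : ℕ) (x : ℕ → ℝ) :
    (((√(n : ℝ))⁻¹) • symmetricCirculant n x).IsHermitian := by
  have h : (symmetricCirculant n x).IsSymm := by
    refine Matrix.Fin.circulant_isSymm_iff.2 fun i => ?_
    have hn : NeZero n := ⟨by have := i.isLt; omega⟩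
    congr 1
    rw [Fin.val_neg]
    have := i.isLt
    split_ifs with h0
    · simp [h0]
    · omega
  ext i j
  have := h.apply i j
  simp [Matrix.conjTranspose_apply, this]

/-- The spectral distribution of a real symmetric `n × n` matrix, `n ≥ 1`: the uniform
distribution on its `n` eigenvalues, counted with multiplicity. -/
def spectralDistribution {n : ℕ} [NeZero n] (A : Matrix (Fin n) (Fin n) ℝ)
    (hA : A.IsHermitian) : ProbabilityMeasure ℝ :=
  ⟨(n : ENNReal)⁻¹ • ∑ i : Fin n, Measure.dirac (hA.eigenvalues i), ⟨by
    simp [ENNReal.inv_mul_cancel (a := (n : ENNReal)) (by simp [NeZero.ne n]) (by simp)]⟩⟩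

theorem lintegral_symmetrizedRayleigh :
    ∫⁻ x : ℝ, ENNReal.ofReal (|x| * Real.exp (-x ^ 2)) = 1 := by
  have h1 : ∫ x : ℝ, |x| * Real.exp (-x ^ 2) = 1 := by
    have h := integral_comp_abs (f := fun x : ℝ => x * Real.exp (-x ^ 2))
    simp only [sq_abs] at h
    rw [h]
    have h2 := integral_rpow_mul_exp_neg_rpow (p := 2) (q := 1) (by norm_num) (by norm_num)
    norm_num at h2
    rw [h2]; norm_num
  have hi : Integrable fun x : ℝ => |x| * Real.exp (-x ^ 2) := by
    by_contra hc
    rw [integral_undef hc] at h1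
    norm_num at h1
  rw [← ofReal_integral_eq_lintegral_ofReal hi (Eventually.of_forall fun x => by positivity), h1]
  simp

/-- The probability law on `ℝ` with density `|x| * exp (-x ^ 2)`. -/
def symmetrizedRayleigh : ProbabilityMeasure ℝ :=
  ⟨volume.withDensity fun x : ℝ => ENNReal.ofReal (|x| * Real.exp (-x ^ 2)), ⟨by
    rw [withDensity_apply _ MeasurableSet.univ, Measure.restrict_univ,
      lintegral_symmetrizedRayleigh]⟩⟩

/-- The standard normal law. -/
def standardNormal : ProbabilityMeasure ℝ := ⟨gaussianReal 0 1, inferInstance⟩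

end

noncomputable section

section EfronStein

theorem MeasureTheory.MeasurePreserving.integral_comp_of_aestronglyMeasurable {β γ : Type*}
    [MeasurableSpace β] [MeasurableSpace γ] {μ : Measure β} {ν : Measure γ} {f : β → γ}
    (hf : MeasurePreserving f μ ν) {g : γ → ℝ} (hg : AEStronglyMeasurable g ν) :
    ∫ x, g (f x) ∂μ = ∫ y, g y ∂ν := by
  rw [← hf.map_eq] at hg ⊢
  exact (integral_map hf.aemeasurable hg).symm

variable {ι α : Type*} [DecidableEq ι]

/-- Exchange the two components of the pairs indexed by `S`. -/
def swapOn (S : Finset ι) (w : ι → α × α) : ι → α × α :=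
  fun i => (if i ∈ S then Prod.swap else id) (w i)

theorem swapOn_empty (w : ι → α × α) : swapOn ∅ w = w := by
  ext i <;> simp [swapOn]

theorem swapOn_swapOn_of_disjoint {R S : Finset ι} (h : Disjoint R S) (w : ι → α × α) :
    swapOn R (swapOn S w) = swapOn (R ∪ S) w := by
  funext i
  by_cases hR : i ∈ R
  · have hS : i ∉ S := Finset.disjoint_left.1 h hR
    simp [swapOn, hR, hS]
  · by_cases hS : i ∈ S <;> simp [swapOn, hR, hS]

theorem swapOn_self (S : Finset ι) (w : ι → α × α) : swapOn S (swapOn S w) = w := by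
  funext i
  by_cases hS : i ∈ S <;> simp [swapOn, hS]

theorem fst_swapOn_singleton (j : ι) (w : ι → α × α) :
    (fun i => (swapOn {j} w i).1) = Function.update (fun i => (w i).1) j (w j).2 := by
  funext i
  by_cases h : i = j
  · subst h; simp [swapOn]
  · simp [swapOn, h]

variable [Fintype ι] [MeasurableSpace α]

theorem measurePreserving_swapOn (μ : ι → Measure α) [∀ i, IsProbabilityMeasure (μ i)]
    (S : Finset ι) :
    MeasurePreserving (swapOn S) (Measure.pi fun i => (μ i).prod (μ i))
      (Measure.pi fun i => (μ i).prod (μ i)) := by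
  refine measurePreserving_pi (fun i => (μ i).prod (μ i)) (fun i => (μ i).prod (μ i))
    (f := fun i => if i ∈ S then Prod.swap else id) fun i => ?_
  split_ifs
  · exact Measure.measurePreserving_swap
  · exact MeasurePreserving.id _

theorem integral_sq_sub_mul_swapOn_le (μ : ι → Measure α) [∀ i, IsProbabilityMeasure (μ i)]
    {f : (ι → α × α) → ℝ} (hf : Measurable f) {C : ℝ} (hC : ∀ w, |f w| ≤ C) (S : Finset ι) :
    ∫ w, f w * (f w - f (swapOn S w)) ∂(Measure.pi fun i => (μ i).prod (μ i)) ≤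
      ∑ j ∈ S, 1 / 2 * ∫ w, (f w - f (swapOn {j} w)) ^ 2
        ∂(Measure.pi fun i => (μ i).prod (μ i)) := by
  set Q := Measure.pi fun i => (μ i).prod (μ i) with hQ
  have hm : ∀ R : Finset ι, Measurable fun w => f (swapOn R w) := fun R =>
    hf.comp (measurePreserving_swapOn μ R).measurable
  have hC0 : ∀ (R : Finset ι) w, |f (swapOn R w)| ≤ C := fun R w => hC _
  have hp : ∀ g h : (ι → α × α) → ℝ, Measurable g → Measurable h → (∀ w, |g w| ≤ 2 * C) →
      (∀ w, |h w| ≤ 2 * C) → Integrable (fun w => g w * h w) Q := by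
    intro g h hg hh hgC hhC
    refine Integrable.of_bound (hg.mul hh).aestronglyMeasurable ((2 * C) * (2 * C))
      (Eventually.of_forall fun w => ?_)
    rw [Real.norm_eq_abs, abs_mul]
    exact mul_le_mul (hgC w) (hhC w) (abs_nonneg _) ((abs_nonneg _).trans (hgC w))
  have hb : ∀ R w, |f (swapOn R w)| ≤ 2 * C := fun R w => by
    have := hC0 R w; have := abs_nonneg (f (swapOn R w)); linarith
  have hb2 : ∀ R R' w, |f (swapOn R w) - f (swapOn R' w)| ≤ 2 * C := fun R R' w => by
    have := abs_sub (f (swapOn R w)) (f (swapOn R' w))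
    have := hC0 R w; have := hC0 R' w; linarith
  induction S using Finset.induction_on with
  | empty => simp [swapOn_empty]
  | insert j S hj ih =>
    rw [Finset.sum_insert hj]
    have hdisj : Disjoint {j} S := by simpa using hj
    have i1 : Integrable (fun w => f w * (f w - f (swapOn S w))) Q := by
      simpa only [swapOn_empty, Pi.sub_apply] using
        hp _ _ (hm ∅) ((hm ∅).sub (hm S)) (hb _) (hb2 _ _)
    have i2 : Integrable (fun w => f w * (f (swapOn S w) - f (swapOn (insert j S) w))) Q := by
      simpa only [swapOn_empty, Pi.sub_apply] using
        hp _ _ (hm ∅) ((hm S).sub (hm (insert j S))) (hb _) (hb2 _ _)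
    have i3 : Integrable
        (fun w => f (swapOn {j} w) * (f (swapOn S w) - f (swapOn (insert j S) w))) Q :=
      hp _ _ (hm _) ((hm _).sub (hm _)) (hb _) (hb2 _ _)
    have i4 : Integrable (fun w => (f w - f (swapOn {j} w)) ^ 2) Q := by
      simpa only [sq, swapOn_empty, Pi.sub_apply] using
        hp _ _ ((hm ∅).sub (hm {j})) ((hm ∅).sub (hm {j})) (hb2 _ _) (hb2 _ _)
    have i5 : Integrable (fun w => (f (swapOn S w) - f (swapOn (insert j S) w)) ^ 2) Q := by
      simp_rw [sq]; exact hp _ _ ((hm _).sub (hm _)) ((hm _).sub (hm _)) (hb2 _ _) (hb2 _ _)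
    have hsplit : ∫ w, f w * (f w - f (swapOn (insert j S) w)) ∂Q =
        ∫ w, f w * (f w - f (swapOn S w)) ∂Q +
          ∫ w, f w * (f (swapOn S w) - f (swapOn (insert j S) w)) ∂Q := by
      rw [← integral_add i1 i2]; congr 1; ext w; ring
    have hins : insert j S = {j} ∪ S := rfl
    have hflip : ∫ w, f w * (f (swapOn S w) - f (swapOn (insert j S) w)) ∂Q =
        - ∫ w, f (swapOn {j} w) * (f (swapOn S w) - f (swapOn (insert j S) w)) ∂Q := by
      have h := (measurePreserving_swapOn μ {j}).integral_comp_of_aestronglyMeasurable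
        (g := fun w => f w * (f (swapOn S w) - f (swapOn (insert j S) w)))
        i2.aestronglyMeasurable
      rw [← hQ] at h
      rw [← h, ← integral_neg]
      congr 1; ext w
      have h1 : swapOn S (swapOn {j} w) = swapOn (insert j S) w := by
        rw [swapOn_swapOn_of_disjoint hdisj.symm, Finset.union_comm]; rfl
      have h2 : swapOn (insert j S) (swapOn {j} w) = swapOn S w := by
        rw [hins, Finset.union_comm, ← swapOn_swapOn_of_disjoint hdisj.symm, swapOn_self]
      rw [h1, h2]; ring
    have hshift : ∫ w, (f (swapOn S w) - f (swapOn (insert j S) w)) ^ 2 ∂Q =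
        ∫ w, (f w - f (swapOn {j} w)) ^ 2 ∂Q := by
      have h := (measurePreserving_swapOn μ S).integral_comp_of_aestronglyMeasurable
        (g := fun w => (f w - f (swapOn {j} w)) ^ 2) i4.aestronglyMeasurable
      rw [← hQ] at h
      rw [← h]
      congr 1; ext w
      rw [swapOn_swapOn_of_disjoint hdisj]; rfl
    have hamgm : ∫ w, f w * (f (swapOn S w) - f (swapOn (insert j S) w)) ∂Q +
        ∫ w, f w * (f (swapOn S w) - f (swapOn (insert j S) w)) ∂Q ≤
        ∫ w, (f w - f (swapOn {j} w)) ^ 2 ∂Q := by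
      nth_rewrite 2 [hflip]
      rw [← integral_neg, ← integral_add i2 i3.fun_neg]
      calc _ ≤ ∫ w, (1 / 2 * (f w - f (swapOn {j} w)) ^ 2 +
              1 / 2 * (f (swapOn S w) - f (swapOn (insert j S) w)) ^ 2) ∂Q := by
            refine integral_mono (i2.add i3.fun_neg) ((i4.const_mul _).add (i5.const_mul _)) fun w => ?_
            nlinarith [sq_nonneg ((f w - f (swapOn {j} w)) -
              (f (swapOn S w) - f (swapOn (insert j S) w)))]
        _ = _ := by
            rw [integral_add (i4.const_mul _) (i5.const_mul _), integral_const_mul,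
              integral_const_mul, hshift]
            ring
    rw [hsplit]
    linarith

/-- The **Efron–Stein inequality** for bounded functions. -/
theorem efron_stein (μ : ι → Measure α) [∀ i, IsProbabilityMeasure (μ i)]
    {h : (ι → α) → ℝ} (hh : Measurable h) {C : ℝ} (hC : ∀ x, |h x| ≤ C) :
    ∫ x, h x ^ 2 ∂Measure.pi μ - (∫ x, h x ∂Measure.pi μ) ^ 2 ≤
      ∑ j, 1 / 2 * ∫ w, (h (fun i => (w i).1) -
        h (Function.update (fun i => (w i).1) j (w j).2)) ^ 2
        ∂(Measure.pi fun i => (μ i).prod (μ i)) := by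
  have hmf : Measurable fun w : ι → α × α => fun i => (w i).1 := by fun_prop
  have hms : Measurable fun w : ι → α × α => fun i => (w i).2 := by fun_prop
  have key := integral_sq_sub_mul_swapOn_le μ (f := fun w => h fun i => (w i).1)
    (hh.comp hmf) (fun w => hC _) Finset.univ
  simp only [fst_swapOn_singleton] at key
  refine le_trans (le_of_eq ?_) key
  have hfst : MeasurePreserving (fun w : ι → α × α => fun i => (w i).1)
      (Measure.pi fun i => (μ i).prod (μ i)) (Measure.pi μ) :=
    measurePreserving_pi _ _ (f := fun _ => Prod.fst) fun i => measurePreserving_fst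
  have hsw : ∀ w : ι → α × α, (fun i => (swapOn Finset.univ w i).1) = fun i => (w i).2 := by
    intro w; funext i; simp [swapOn]
  simp only [hsw, mul_sub]
  have hbd : ∀ g : (ι → α × α) → ι → α, Measurable g → Integrable
      (fun w => h (fun i => (w i).1) * h (g w)) (Measure.pi fun i => (μ i).prod (μ i)) := by
    intro g hg
    refine Integrable.of_bound ((hh.comp hmf).mul (hh.comp hg)).aestronglyMeasurable (C * C)
      (Eventually.of_forall fun w => ?_)
    rw [Real.norm_eq_abs, abs_mul]
    exact mul_le_mul (hC _) (hC _) (abs_nonneg _) ((abs_nonneg _).trans (hC fun i => (w i).1))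
  rw [integral_sub (hbd _ hmf) (hbd _ hms)]
  congr 1
  · rw [← hfst.integral_comp_of_aestronglyMeasurable
      (g := fun x => h x ^ 2) (hh.pow_const 2).aestronglyMeasurable]
    simp only [sq]
  · have e := measurePreserving_arrowProdEquivProdArrow α α ι μ μ
    have := e.integral_comp (MeasurableEquiv.measurableEmbedding _)
      (fun p : (ι → α) × (ι → α) => h p.1 * h p.2)
    rw [sq, ← integral_prod_mul, ← this]
    rfl

/-- Fourth moment concentration of a bounded function whose squared increments under single
coordinate changes have a bounded sum. -/
theorem integral_sub_integral_pow_four_le (μ : ι → Measure α) [∀ i, IsProbabilityMeasure (μ i)]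
    {G : (ι → α) → ℝ} (hG : Measurable G) {C : ℝ} (hC : ∀ x, |G x| ≤ C) {κ : ℝ}
    (hκ : ∀ x y : ι → α, ∑ j, (G x - G (Function.update x j (y j))) ^ 2 ≤ κ) :
    ∫ x, (G x - ∫ z, G z ∂Measure.pi μ) ^ 4 ∂Measure.pi μ ≤ 4 * κ ^ 2 := by
  set m := ∫ z, G z ∂Measure.pi μ with hm
  set Q := Measure.pi fun i => (μ i).prod (μ i) with hQ
  set u : (ι → α) → ℝ := fun x => G x - m with hu
  have hum : Measurable u := hG.sub_const _
  have huC : ∀ x, |u x| ≤ C + |m| := fun x => by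
    have := abs_sub (G x) m; have := hC x; simp only [hu]; linarith
  have hmf : Measurable fun w : ι → α × α => fun i => (w i).1 := by fun_prop
  have hmu : ∀ j, Measurable fun w : ι → α × α =>
      Function.update (fun i => (w i).1) j (w j).2 := fun j => by
    rw [← funext (fst_swapOn_singleton j)]
    exact hmf.comp (measurePreserving_swapOn μ {j}).measurable
  have hfst : MeasurePreserving (fun w : ι → α × α => fun i => (w i).1) Q (Measure.pi μ) :=
    measurePreserving_pi _ _ (f := fun _ => Prod.fst) fun i => measurePreserving_fst
  have hint : ∀ (p : ℕ), Integrable (fun x => u x ^ p) (Measure.pi μ) := fun p =>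
    Integrable.of_bound (hum.pow_const p).aestronglyMeasurable ((C + |m|) ^ p)
      (Eventually.of_forall fun x => by
        rw [norm_pow, Real.norm_eq_abs]; exact pow_le_pow_left₀ (abs_nonneg _) (huC x) p)
  have hCm : 0 ≤ C + |m| ∨ IsEmpty (ι → α) := by
    rcases isEmpty_or_nonempty (ι → α) with h | ⟨⟨x⟩⟩
    · exact Or.inr h
    · exact Or.inl ((abs_nonneg _).trans (huC x))
  have hmean : ∫ x, u x ∂Measure.pi μ = 0 := by
    have hGi : Integrable G (Measure.pi μ) :=
      Integrable.of_bound hG.aestronglyMeasurable C (Eventually.of_forall fun x => hC x)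
    simp [hu, integral_sub hGi (integrable_const _), hm]
  have hinc : ∀ (w : ι → α × α), ∑ j, (u (fun i => (w i).1) -
      u (Function.update (fun i => (w i).1) j (w j).2)) ^ 2 ≤ κ := fun w => by
    simpa [hu] using hκ (fun i => (w i).1) (fun i => (w i).2)
  have hκ0 : 0 ≤ κ := by
    rcases hCm with h | h
    · have : Nonempty (ι → α × α) := by
        by_contra hc
        rw [not_nonempty_iff] at hc
        have : Q Set.univ = 0 := by rw [Set.univ_eq_empty_iff.2 hc]; simp
        simp [hQ] at this
      obtain ⟨w⟩ := this
      exact (Finset.sum_nonneg fun j _ => sq_nonneg _).trans (hinc w)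
    · have : (Measure.pi μ) Set.univ = 0 := by rw [Set.univ_eq_empty_iff.2 h]; simp
      simp at this
  have hincj : ∀ (w : ι → α × α) j, (u (fun i => (w i).1) -
      u (Function.update (fun i => (w i).1) j (w j).2)) ^ 2 ≤ κ := fun w j =>
    (Finset.single_le_sum (f := fun j => (u (fun i => (w i).1) -
      u (Function.update (fun i => (w i).1) j (w j).2)) ^ 2) (fun j _ => sq_nonneg _)
      (Finset.mem_univ j)).trans (hinc w)
  have hintj : ∀ (p : ℕ) j, Integrable (fun w : ι → α × α => (u (fun i => (w i).1) ^ p -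
      u (Function.update (fun i => (w i).1) j (w j).2) ^ p) ^ 2) Q := fun p j => by
    have hb : ∀ x, |u x ^ p| ≤ (C + |m|) ^ p := fun x => by
      rw [abs_pow]; exact pow_le_pow_left₀ (abs_nonneg _) (huC x) p
    refine Integrable.of_bound ((((hum.comp hmf).pow_const p).sub
      ((hum.comp (hmu j)).pow_const p)).pow_const 2).aestronglyMeasurable
      ((2 * (C + |m|) ^ p) ^ 2) (Eventually.of_forall fun w => ?_)
    rw [norm_pow, Real.norm_eq_abs]
    refine pow_le_pow_left₀ (abs_nonneg _) ?_ 2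
    have := abs_sub (u (fun i => (w i).1) ^ p)
      (u (Function.update (fun i => (w i).1) j (w j).2) ^ p)
    have := hb (fun i => (w i).1)
    have := hb (Function.update (fun i => (w i).1) j (w j).2)
    linarith
  have hvar : ∫ x, u x ^ 2 ∂Measure.pi μ ≤ κ / 2 := by
    have h := efron_stein μ hum huC
    rw [hmean, ← hQ, ← Finset.mul_sum, ← integral_finsetSum _
      fun j _ => by simpa using hintj 1 j] at h
    have h2 : ∫ w, ∑ j, (u (fun i => (w i).1) -
        u (Function.update (fun i => (w i).1) j (w j).2)) ^ 2 ∂Q ≤ ∫ _, κ ∂Q :=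
      integral_mono (integrable_finsetSum _ fun j _ => by simpa using hintj 1 j)
        (integrable_const _) hinc
    simp only [integral_const, probReal_univ, smul_eq_mul, one_mul] at h2
    linarith
  have h4 := efron_stein μ (hum.pow_const 2) (C := (C + |m|) ^ 2) fun x => by
    rw [abs_pow]; exact pow_le_pow_left₀ (abs_nonneg _) (huC x) 2
  rw [← hQ, ← Finset.mul_sum, ← integral_finsetSum _ fun j _ => hintj 2 j] at h4
  have h5 : ∫ w, ∑ j, (u (fun i => (w i).1) ^ 2 -
      u (Function.update (fun i => (w i).1) j (w j).2) ^ 2) ^ 2 ∂Q ≤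
      ∫ w, (8 * κ * u (fun i => (w i).1) ^ 2 + 2 * κ ^ 2) ∂Q := by
    refine integral_mono (integrable_finsetSum _ fun j _ => hintj 2 j)
      (((hfst.integrable_comp_of_integrable (hint 2)).const_mul _).add (integrable_const _))
      fun w => ?_
    have hterm : ∀ j, (u (fun i => (w i).1) ^ 2 -
        u (Function.update (fun i => (w i).1) j (w j).2) ^ 2) ^ 2 ≤
        (u (fun i => (w i).1) - u (Function.update (fun i => (w i).1) j (w j).2)) ^ 2 *
          (8 * u (fun i => (w i).1) ^ 2 + 2 * κ) := fun j => by
      have h1 := hincj w j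
      set p := u (fun i => (w i).1)
      set q := u (Function.update (fun i => (w i).1) j (w j).2)
      have : (p ^ 2 - q ^ 2) ^ 2 = (p - q) ^ 2 * (p + q) ^ 2 := by ring
      rw [this]
      refine mul_le_mul_of_nonneg_left ?_ (sq_nonneg _)
      nlinarith [sq_nonneg (2 * p + (p - q))]
    calc _ ≤ ∑ j, (u (fun i => (w i).1) -
            u (Function.update (fun i => (w i).1) j (w j).2)) ^ 2 *
          (8 * u (fun i => (w i).1) ^ 2 + 2 * κ) := Finset.sum_le_sum fun j _ => hterm j
      _ ≤ κ * (8 * u (fun i => (w i).1) ^ 2 + 2 * κ) := by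
        rw [← Finset.sum_mul]
        exact mul_le_mul_of_nonneg_right (hinc w) (by positivity)
      _ = _ := by ring
  have hu2 : Integrable (fun w : ι → α × α => u (fun i => (w i).1) ^ 2) Q :=
    hfst.integrable_comp_of_integrable (hint 2)
  have h6 : ∫ w, (8 * κ * u (fun i => (w i).1) ^ 2 + 2 * κ ^ 2) ∂Q =
      8 * κ * ∫ x, u x ^ 2 ∂Measure.pi μ + 2 * κ ^ 2 := by
    have hcomp : ∫ w, u (fun i => (w i).1) ^ 2 ∂Q = ∫ x, u x ^ 2 ∂Measure.pi μ :=
      hfst.integral_comp_of_aestronglyMeasurable (g := fun x => u x ^ 2)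
        (hum.pow_const 2).aestronglyMeasurable
    rw [integral_add (hu2.const_mul _) (integrable_const _), integral_const_mul, hcomp]
    simp
  have hv0 : 0 ≤ ∫ x, u x ^ 2 ∂Measure.pi μ := integral_nonneg fun x => sq_nonneg _
  have h7 : ∫ x, (u x ^ 2) ^ 2 ∂Measure.pi μ = ∫ x, u x ^ 4 ∂Measure.pi μ := by
    congr 1; ext x; ring
  rw [h7] at h4
  nlinarith

end EfronStein

section Taylor

theorem norm_cexp_mul_I_sub_one_sub_le (x : ℝ) :
    ‖Complex.exp (x * Complex.I) - 1 - x * Complex.I‖ ≤ 3 * x ^ 2 := by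
  have hn : ‖(x : ℂ) * Complex.I‖ = |x| := by simp
  rcases le_total |x| 1 with h | h
  · have := Complex.norm_exp_sub_one_sub_id_le (x := x * Complex.I) (by rwa [hn])
    rw [hn, sq_abs] at this
    nlinarith [sq_nonneg x]
  · have h1 : ‖Complex.exp (x * Complex.I) - 1 - x * Complex.I‖ ≤ 1 + 1 + |x| := by
      refine (norm_sub_le _ _).trans (add_le_add ((norm_sub_le _ _).trans ?_) hn.le)
      simp [Complex.norm_exp_ofReal_mul_I]
    have : x ^ 2 = |x| ^ 2 := (sq_abs x).symm
    nlinarith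

theorem norm_cexp_mul_I_sub_quadratic_le (x : ℝ) :
    ‖Complex.exp (x * Complex.I) - (1 + x * Complex.I - x ^ 2 / 2)‖ ≤ 4 * |x| ^ 3 := by
  have hn : ‖(x : ℂ) * Complex.I‖ = |x| := by simp
  rcases le_total |x| 1 with h | h
  · have := Complex.exp_bound (x := x * Complex.I) (by rwa [hn]) (n := 3) (by norm_num)
    rw [hn] at this
    have e : ∑ m ∈ Finset.range 3, ((x : ℂ) * Complex.I) ^ m / (m.factorial : ℂ) =
        1 + x * Complex.I - x ^ 2 / 2 := by
      simp [Finset.sum_range_succ, Nat.factorial, mul_pow]; ring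
    rw [e] at this
    refine this.trans ?_
    norm_num [Nat.factorial]
    nlinarith [pow_nonneg (abs_nonneg x) 3]
  · have h1 : ‖Complex.exp (x * Complex.I) - (1 + x * Complex.I - x ^ 2 / 2)‖ ≤
        1 + (1 + |x| + |x| ^ 2 / 2) := by
      refine (norm_sub_le _ _).trans (add_le_add (by simp [Complex.norm_exp_ofReal_mul_I]) ?_)
      refine (norm_sub_le _ _).trans (add_le_add ((norm_add_le _ _).trans ?_) ?_)
      · simp
      · simp
    nlinarith [pow_le_pow_left₀ zero_le_one h 2, mul_nonneg (abs_nonneg x) (sub_nonneg.2 h),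
      mul_nonneg (sq_nonneg |x|) (sub_nonneg.2 h)]

theorem abs_exp_neg_sq_half_sub_le (x : ℝ) :
    |Real.exp (-(x ^ 2 / 2)) - (1 - x ^ 2 / 2)| ≤ |x| ^ 3 := by
  have hx : x ^ 2 = |x| ^ 2 := (sq_abs x).symm
  have h0 := abs_nonneg x
  rw [hx]
  set y := |x|
  rcases le_total y 1 with h | h
  · have := Real.abs_exp_sub_one_sub_id_le (x := -(y ^ 2 / 2))
      (by rw [abs_neg, abs_of_nonneg (by positivity)]; nlinarith)
    have e : Real.exp (-(y ^ 2 / 2)) - 1 - -(y ^ 2 / 2) =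
      Real.exp (-(y ^ 2 / 2)) - (1 - y ^ 2 / 2) := by ring
    rw [e] at this
    refine this.trans ?_
    nlinarith [pow_nonneg h0 3, mul_nonneg (pow_nonneg h0 3) (sub_nonneg.2 h)]
  · have h1 := Real.add_one_le_exp (-(y ^ 2 / 2))
    have h2 : Real.exp (-(y ^ 2 / 2)) ≤ 1 := Real.exp_le_one_iff.2 (by nlinarith)
    rw [abs_of_nonneg (by linarith)]
    nlinarith [mul_nonneg (sq_nonneg y) (sub_nonneg.2 h)]

theorem norm_prod_sub_prod_le {ι : Type*} (s : Finset ι) (f g : ι → ℂ)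
    (hf : ∀ i, ‖f i‖ ≤ 1) (hg : ∀ i, ‖g i‖ ≤ 1) :
    ‖∏ i ∈ s, f i - ∏ i ∈ s, g i‖ ≤ ∑ i ∈ s, ‖f i - g i‖ := by
  classical
  induction s using Finset.induction_on with
  | empty => simp
  | insert i s hi ih =>
    rw [Finset.prod_insert hi, Finset.prod_insert hi, Finset.sum_insert hi]
    have e : f i * ∏ x ∈ s, f x - g i * ∏ x ∈ s, g x =
      (f i - g i) * ∏ x ∈ s, f x + g i * (∏ x ∈ s, f x - ∏ x ∈ s, g x) := by ring
    rw [e]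
    refine (norm_add_le _ _).trans (add_le_add ?_ ?_)
    · rw [norm_mul]
      refine mul_le_of_le_one_right (norm_nonneg _) ?_
      rw [norm_prod]
      exact Finset.prod_le_one (fun _ _ => norm_nonneg _) fun i _ => hf i
    · rw [norm_mul]
      exact (mul_le_of_le_one_left (norm_nonneg _) (hg i)).trans ih

end Taylor

section Expectation

variable {Ω : Type*} [MeasurableSpace Ω] {P : Measure Ω} [IsProbabilityMeasure P]

theorem norm_integral_cexp_sub_gaussian_le {X : Ω → ℝ} (hX : Measurable X)
    (hmean : ∫ ω, X ω ∂P = 0) (hvar : ∫ ω, X ω ^ 2 ∂P = 1)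
    (hint : Integrable (fun ω => |X ω| ^ 3) P) {M : ℝ} (hM : ∫ ω, |X ω| ^ 3 ∂P ≤ M) (a : ℝ) :
    ‖∫ ω, Complex.exp ((X ω * a : ℝ) * Complex.I) ∂P - Real.exp (-(a ^ 2 / 2))‖ ≤
      (4 * M + 1) * |a| ^ 3 := by
  have h2 : Integrable (fun ω => X ω ^ 2) P := by
    by_contra hc
    rw [integral_undef hc] at hvar
    norm_num at hvar
  have h1 : Integrable X P := by
    have : MemLp X 2 P := (memLp_two_iff_integrable_sq hX.aestronglyMeasurable).2 h2
    exact this.integrable (by norm_num)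
  have he : Integrable (fun ω => Complex.exp ((X ω * a : ℝ) * Complex.I)) P :=
    Integrable.of_bound (by fun_prop) 1
      (Eventually.of_forall fun ω => (Complex.norm_exp_ofReal_mul_I _).le)
  have hq : ∫ ω, (1 + ((X ω * a : ℝ) : ℂ) * Complex.I - ((X ω * a : ℝ) : ℂ) ^ 2 / 2) ∂P =
      1 - (a : ℂ) ^ 2 / 2 := by
    have e1 : ∫ ω, ((X ω : ℝ) : ℂ) ∂P = 0 := by rw [integral_complex_ofReal, hmean]; simp
    have e2 : ∫ ω, ((X ω : ℝ) : ℂ) ^ 2 ∂P = 1 := by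
      have : ∀ ω, ((X ω : ℝ) : ℂ) ^ 2 = ((X ω ^ 2 : ℝ) : ℂ) := fun ω => by simp
      simp_rw [this]
      rw [integral_complex_ofReal, hvar]; simp
    have i1 : Integrable (fun ω => ((X ω : ℝ) : ℂ) * (a * Complex.I)) P := h1.ofReal.mul_const _
    have i2 : Integrable (fun ω => ((X ω : ℝ) : ℂ) ^ 2 * ((a : ℂ) ^ 2 / 2)) P := by
      have := (h2.ofReal (𝕜 := ℂ)).mul_const ((a : ℂ) ^ 2 / 2)
      simpa using this
    calc _ = ∫ ω, ((1 + ((X ω : ℝ) : ℂ) * (a * Complex.I)) -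
            ((X ω : ℝ) : ℂ) ^ 2 * ((a : ℂ) ^ 2 / 2)) ∂P := by
          congr 1; ext ω; push_cast; ring
      _ = _ := by
          have i0 : Integrable (fun ω => 1 + ((X ω : ℝ) : ℂ) * (a * Complex.I)) P :=
            (integrable_const 1).add i1
          rw [integral_sub i0 i2, integral_add (integrable_const _) i1,
            integral_mul_const, integral_mul_const, e1, e2]
          simp
  have hiq : Integrable (fun ω => (1 + ((X ω * a : ℝ) : ℂ) * Complex.I -
      ((X ω * a : ℝ) : ℂ) ^ 2 / 2)) P := by
    have i1 : Integrable (fun ω => ((X ω * a : ℝ) : ℂ) * Complex.I) P :=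
      ((h1.mul_const a).ofReal).mul_const _
    have i2 : Integrable (fun ω => ((X ω * a : ℝ) : ℂ) ^ 2 / 2) P := by
      have := ((h2.mul_const (a ^ 2)).ofReal (𝕜 := ℂ)).div_const 2
      refine this.congr (Eventually.of_forall fun ω => ?_)
      simp only [RCLike.ofReal_mul, RCLike.ofReal_pow, Complex.coe_algebraMap,
        Complex.ofReal_mul]
      simp [mul_pow]
    exact ((integrable_const _).add i1).sub i2
  have hA : ‖∫ ω, Complex.exp ((X ω * a : ℝ) * Complex.I) ∂P - (1 - (a : ℂ) ^ 2 / 2)‖ ≤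
      4 * M * |a| ^ 3 := by
    rw [← hq, ← integral_sub he hiq]
    calc _ ≤ ∫ ω, 4 * |a| ^ 3 * |X ω| ^ 3 ∂P := by
          refine norm_integral_le_of_norm_le (hint.const_mul _) (Eventually.of_forall fun ω => ?_)
          refine (norm_cexp_mul_I_sub_quadratic_le _).trans (le_of_eq ?_)
          rw [abs_mul, mul_pow]; ring
      _ ≤ _ := by
          rw [integral_const_mul]
          have : 0 ≤ 4 * |a| ^ 3 := by positivity
          nlinarith
  have hB : ‖(1 - (a : ℂ) ^ 2 / 2) - Real.exp (-(a ^ 2 / 2))‖ ≤ |a| ^ 3 := by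
    have h := abs_exp_neg_sq_half_sub_le a
    rw [abs_sub_comm, ← Real.norm_eq_abs, ← Complex.norm_real] at h
    simpa using h
  have := norm_sub_le_norm_sub_add_norm_sub
    (∫ ω, Complex.exp ((X ω * a : ℝ) * Complex.I) ∂P) (1 - (a : ℂ) ^ 2 / 2)
    ((Real.exp (-(a ^ 2 / 2)) : ℝ) : ℂ)
  linarith

theorem norm_integral_cexp_sum_sub_gaussian_le {m : ℕ} {X : Fin m → Ω → ℝ}
    (hX : ∀ j, Measurable (X j)) (hindep : iIndepFun X P)
    (hmean : ∀ j, ∫ ω, X j ω ∂P = 0) (hvar : ∀ j, ∫ ω, X j ω ^ 2 ∂P = 1)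
    (hint : ∀ j, Integrable (fun ω => |X j ω| ^ 3) P) {M : ℝ}
    (hM : ∀ j, ∫ ω, |X j ω| ^ 3 ∂P ≤ M) (a : Fin m → ℝ) :
    ‖∫ ω, Complex.exp ((∑ j, X j ω * a j : ℝ) * Complex.I) ∂P -
      Real.exp (-((∑ j, a j ^ 2) / 2))‖ ≤ (4 * M + 1) * ∑ j, |a j| ^ 3 := by
  have e1 : ∫ ω, Complex.exp ((∑ j, X j ω * a j : ℝ) * Complex.I) ∂P =
      ∏ j, ∫ ω, Complex.exp ((X j ω * a j : ℝ) * Complex.I) ∂P := by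
    rw [← hindep.integral_fun_prod_comp (fun j => (hX j).aemeasurable)
      (f := fun j x => Complex.exp ((x * a j : ℝ) * Complex.I))
      (fun j => (by fun_prop : Measurable fun x : ℝ =>
        Complex.exp ((x * a j : ℝ) * Complex.I)).aestronglyMeasurable)]
    congr 1; ext ω
    rw [← Complex.exp_sum, Complex.ofReal_sum, Finset.sum_mul]
  have e2 : ((Real.exp (-((∑ j, a j ^ 2) / 2)) : ℝ) : ℂ) =
      ∏ j, ((Real.exp (-(a j ^ 2 / 2)) : ℝ) : ℂ) := by
    rw [← Complex.ofReal_prod, ← Real.exp_sum, Finset.sum_neg_distrib, Finset.sum_div]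
  rw [e1, e2, Finset.mul_sum]
  refine (norm_prod_sub_prod_le _ _ _ (fun j => ?_) fun j => ?_).trans
    (Finset.sum_le_sum fun j _ =>
      norm_integral_cexp_sub_gaussian_le (hX j) (hmean j) (hvar j) (hint j) (hM j) (a j))
  · refine (norm_integral_le_of_norm_le_const (C := 1) (Eventually.of_forall fun ω =>
      (Complex.norm_exp_ofReal_mul_I _).le)).trans ?_
    simp
  · rw [Complex.norm_real, Real.norm_eq_abs, abs_of_nonneg (Real.exp_nonneg _)]
    exact Real.exp_le_one_iff.2 (by have := sq_nonneg (a j); linarith)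

/-- The empirical characteristic function of the linear forms `∑ j, x j * a k j`. -/
def empiricalCharFun {m : ℕ} (a : Fin m → Fin m → ℝ) (x : Fin m → ℝ) : ℂ :=
  (m : ℂ)⁻¹ * ∑ k, Complex.exp ((∑ j, x j * a k j : ℝ) * Complex.I)

theorem measurable_empiricalCharFun {m : ℕ} (a : Fin m → Fin m → ℝ) :
    Measurable (empiricalCharFun a) := by
  unfold empiricalCharFun; fun_prop

theorem norm_empiricalCharFun_le {m : ℕ} (a : Fin m → Fin m → ℝ) (x : Fin m → ℝ) :
    ‖empiricalCharFun a x‖ ≤ 1 := by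
  rw [empiricalCharFun, norm_mul, norm_inv, Complex.norm_natCast]
  have : ‖∑ k, Complex.exp ((∑ j, x j * a k j : ℝ) * Complex.I)‖ ≤ m := by
    refine (norm_sum_le _ _).trans ?_
    simp [Complex.norm_exp_ofReal_mul_I, -Complex.ofReal_sum]
  refine (mul_le_mul_of_nonneg_left this (by positivity)).trans ?_
  exact inv_mul_le_one

theorem abs_exp_neg_sub_exp_neg_le {x y : ℝ} (hx : 0 ≤ x) (hy : 0 ≤ y) :
    |Real.exp (-x) - Real.exp (-y)| ≤ |x - y| := by
  wlog h : x ≤ y generalizing x y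
  · rw [abs_sub_comm, abs_sub_comm x]; exact this hy hx (le_of_not_ge h)
  have h1 : Real.exp (-x) - Real.exp (-y) = Real.exp (-x) * (1 - Real.exp (-(y - x))) := by
    rw [mul_sub, ← Real.exp_add]; ring_nf
  have h2 := Real.add_one_le_exp (-(y - x))
  have h3 : Real.exp (-x) ≤ 1 := Real.exp_le_one_iff.2 (by linarith)
  have h4 : Real.exp (-(y - x)) ≤ 1 := Real.exp_le_one_iff.2 (by linarith)
  rw [h1, abs_of_nonneg (mul_nonneg (Real.exp_nonneg _) (by linarith)), abs_sub_comm,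
    abs_of_nonneg (by linarith : 0 ≤ y - x)]
  nlinarith [Real.exp_nonneg (-x)]

theorem norm_integral_empiricalCharFun_sub_le {m : ℕ} (hm : 0 < m) {X : Fin m → Ω → ℝ}
    (hX : ∀ j, Measurable (X j)) (hindep : iIndepFun X P)
    (hmean : ∀ j, ∫ ω, X j ω ∂P = 0) (hvar : ∀ j, ∫ ω, X j ω ^ 2 ∂P = 1)
    (hint : ∀ j, Integrable (fun ω => |X j ω| ^ 3) P) {M : ℝ} (hM0 : 0 ≤ M)
    (hM : ∀ j, ∫ ω, |X j ω| ^ 3 ∂P ≤ M) (a : Fin m → Fin m → ℝ) {c : ℝ}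
    (hc : ∀ k j, |a k j| ≤ c / √m) {s : ℝ} (hs : 0 ≤ s) :
    ‖∫ ω, empiricalCharFun a (fun j => X j ω) ∂P - Real.exp (-(s / 2))‖ ≤
      (4 * M + 1) * c ^ 3 / √m + (m : ℝ)⁻¹ * ∑ k, |∑ j, a k j ^ 2 - s| := by
  have hm' : (0 : ℝ) < m := Nat.cast_pos.2 hm
  have hi : ∀ k, Integrable (fun ω => Complex.exp ((∑ j, X j ω * a k j : ℝ) * Complex.I)) P :=
    fun k => Integrable.of_bound (by fun_prop) 1
      (Eventually.of_forall fun ω => (Complex.norm_exp_ofReal_mul_I _).le)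
  have e : ∫ ω, empiricalCharFun a (fun j => X j ω) ∂P - Real.exp (-(s / 2)) =
      (m : ℂ)⁻¹ * ∑ k, (∫ ω, Complex.exp ((∑ j, X j ω * a k j : ℝ) * Complex.I) ∂P -
        Real.exp (-(s / 2))) := by
    simp only [empiricalCharFun]
    rw [integral_const_mul, integral_finsetSum _ fun k _ => hi k, Finset.sum_sub_distrib, mul_sub]
    congr 1
    simp [hm.ne']
  have hk : ∀ k, ‖∫ ω, Complex.exp ((∑ j, X j ω * a k j : ℝ) * Complex.I) ∂P -
      Real.exp (-(s / 2))‖ ≤ (4 * M + 1) * c ^ 3 / √m + |∑ j, a k j ^ 2 - s| := by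
    intro k
    have h1 := norm_integral_cexp_sum_sub_gaussian_le hX hindep hmean hvar hint hM (a k)
    have h2 : ∑ j, |a k j| ^ 3 ≤ c ^ 3 / √m := by
      calc _ ≤ ∑ _j : Fin m, (c / √m) ^ 3 :=
            Finset.sum_le_sum fun j _ => pow_le_pow_left₀ (abs_nonneg _) (hc k j) 3
        _ = _ := by
            simp only [Finset.sum_const, Finset.card_univ, Fintype.card_fin, nsmul_eq_mul]
            have := Real.sqrt_pos.2 hm'
            have h3 : (m : ℝ) = √m ^ 2 := (Real.sq_sqrt hm'.le).symm
            rw [div_pow]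
            nth_rewrite 1 [h3]
            field_simp
    have h3 : ‖((Real.exp (-((∑ j, a k j ^ 2) / 2)) : ℝ) : ℂ) -
        ((Real.exp (-(s / 2)) : ℝ) : ℂ)‖ ≤ |∑ j, a k j ^ 2 - s| := by
      rw [← Complex.ofReal_sub, Complex.norm_real, Real.norm_eq_abs]
      refine (abs_exp_neg_sub_exp_neg_le
        (div_nonneg (Finset.sum_nonneg fun j _ => sq_nonneg _) zero_le_two)
        (by linarith)).trans ?_
      rw [← sub_div, abs_div, abs_two]
      have := abs_nonneg (∑ j, a k j ^ 2 - s)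
      linarith
    have h4 : (4 * M + 1) * ∑ j, |a k j| ^ 3 ≤ (4 * M + 1) * c ^ 3 / √m := by
      rw [mul_div_assoc]; exact mul_le_mul_of_nonneg_left h2 (by linarith)
    exact (norm_sub_le_norm_sub_add_norm_sub _ _ _).trans (add_le_add (h1.trans h4) h3)
  rw [e, norm_mul, norm_inv, Complex.norm_natCast]
  calc _ ≤ (m : ℝ)⁻¹ * ∑ k : Fin m, ((4 * M + 1) * c ^ 3 / √m + |∑ j, a k j ^ 2 - s|) :=
        mul_le_mul_of_nonneg_left
          ((norm_sum_le _ _).trans (Finset.sum_le_sum fun k _ => hk k)) (by positivity)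
    _ = _ := by
        rw [Finset.sum_add_distrib, mul_add]
        congr 1
        simp [hm.ne']

end Expectation

section Concentration

theorem sum_sq_sum_mul_le_of_dual {m : ℕ} {a : Fin m → Fin m → ℝ} {D : ℝ} (hD0 : 0 ≤ D)
    (hD : ∀ z : Fin m → ℝ, ∑ k, (∑ j, z j * a k j) ^ 2 ≤ D * ∑ j, z j ^ 2) (w : Fin m → ℝ) :
    ∑ j, (∑ k, w k * a k j) ^ 2 ≤ D * ∑ k, w k ^ 2 := by
  set y : Fin m → ℝ := fun j => ∑ k, w k * a k j with hy
  have hS0 : 0 ≤ ∑ j, y j ^ 2 := Finset.sum_nonneg fun _ _ => sq_nonneg _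
  have hW0 : 0 ≤ ∑ k, w k ^ 2 := Finset.sum_nonneg fun _ _ => sq_nonneg _
  have e : ∑ j, y j ^ 2 = ∑ k, w k * ∑ j, y j * a k j := by
    calc _ = ∑ j, ∑ k, w k * (y j * a k j) := by
          refine Finset.sum_congr rfl fun j _ => ?_
          rw [sq]
          nth_rewrite 2 [hy]
          rw [Finset.mul_sum]
          exact Finset.sum_congr rfl fun k _ => by ring
      _ = _ := by rw [Finset.sum_comm]; simp_rw [Finset.mul_sum]
  have h1 := Finset.sum_mul_sq_le_sq_mul_sq Finset.univ w fun k => ∑ j, y j * a k j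
  rw [← e] at h1
  have h2 := h1.trans (mul_le_mul_of_nonneg_left (hD y) hW0)
  rcases hS0.eq_or_lt with h | h
  · change ∑ j, y j ^ 2 ≤ _
    rw [← h]; positivity
  · change ∑ j, y j ^ 2 ≤ _
    by_contra hc
    push Not at hc
    nlinarith [mul_lt_mul_of_pos_right hc h]

theorem sum_norm_sq_empiricalCharFun_sub_update_le {m : ℕ} (hm : 0 < m)
    {a : Fin m → Fin m → ℝ} {c D L : ℝ} (hc : ∀ k j, |a k j| ≤ c / √m) (hD0 : 0 ≤ D)
    (hD : ∀ z : Fin m → ℝ, ∑ k, (∑ j, z j * a k j) ^ 2 ≤ D * ∑ j, z j ^ 2)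
    (x y : Fin m → ℝ) (hL : ∀ j, |y j - x j| ≤ L) :
    ∑ j, ‖empiricalCharFun a x - empiricalCharFun a (Function.update x j (y j))‖ ^ 2 ≤
      (2 * L ^ 2 * D + 18 * L ^ 4 * c ^ 4) / m := by
  have hm' : (0 : ℝ) < m := Nat.cast_pos.2 hm
  set S : Fin m → ℝ := fun k => ∑ j, x j * a k j with hS
  set d : Fin m → ℝ := fun j => y j - x j with hd
  have hupd : ∀ j k, ∑ i, Function.update x j (y j) i * a k i = S k + d j * a k j := by
    intro j k
    have : ∀ i, Function.update x j (y j) i * a k i =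
        x i * a k i + if i = j then d j * a k j else 0 := by
      intro i
      by_cases h : i = j
      · subst h; simp [hd]; ring
      · simp [h]
    simp_rw [this, Finset.sum_add_distrib]
    simp [hS]
  set g : Fin m → ℂ := fun j => ∑ k, Complex.exp (S k * Complex.I) * a k j with hg
  have hgre : ∀ j, ‖g j‖ ^ 2 = (∑ k, Real.cos (S k) * a k j) ^ 2 +
      (∑ k, Real.sin (S k) * a k j) ^ 2 := by
    intro j
    rw [← Complex.normSq_eq_norm_sq, Complex.normSq_apply]
    have h1 : (g j).re = ∑ k, Real.cos (S k) * a k j := by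
      simp [hg, Complex.exp_ofReal_mul_I_re]
    have h2 : (g j).im = ∑ k, Real.sin (S k) * a k j := by
      simp [hg, Complex.exp_ofReal_mul_I_im]
    rw [h1, h2]; ring
  have hgsum : ∑ j, ‖g j‖ ^ 2 ≤ D * m := by
    simp_rw [hgre, Finset.sum_add_distrib]
    refine (add_le_add (sum_sq_sum_mul_le_of_dual hD0 hD fun k => Real.cos (S k))
      (sum_sq_sum_mul_le_of_dual hD0 hD fun k => Real.sin (S k))).trans (le_of_eq ?_)
    rw [← mul_add, ← Finset.sum_add_distrib]
    simp
  have hL0 : 0 ≤ L := (abs_nonneg _).trans (hL ⟨0, hm⟩)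
  have hterm : ∀ j, ‖empiricalCharFun a x - empiricalCharFun a (Function.update x j (y j))‖ ≤
      (m : ℝ)⁻¹ * (L * ‖g j‖ + 3 * L ^ 2 * c ^ 2) := by
    intro j
    have e : empiricalCharFun a x - empiricalCharFun a (Function.update x j (y j)) =
        -((m : ℂ)⁻¹ * (d j * Complex.I * g j + ∑ k, Complex.exp (S k * Complex.I) *
          (Complex.exp ((d j * a k j : ℝ) * Complex.I) - 1 - (d j * a k j : ℝ) * Complex.I))) := by
      simp only [empiricalCharFun, hupd]
      rw [← mul_sub, ← mul_neg, ← Finset.sum_sub_distrib]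
      congr 1
      rw [hg, Finset.mul_sum, ← Finset.sum_add_distrib, ← Finset.sum_neg_distrib]
      refine Finset.sum_congr rfl fun k _ => ?_
      have : Complex.exp (((S k + d j * a k j : ℝ) : ℂ) * Complex.I) =
          Complex.exp (S k * Complex.I) * Complex.exp ((d j * a k j : ℝ) * Complex.I) := by
        rw [← Complex.exp_add]; congr 1; push_cast; ring
      rw [this]
      change Complex.exp (S k * Complex.I) - _ = _
      push_cast
      ring
    rw [e, norm_neg, norm_mul, norm_inv, Complex.norm_natCast]
    refine mul_le_mul_of_nonneg_left ((norm_add_le _ _).trans (add_le_add ?_ ?_)) (by positivity)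
    · rw [norm_mul, norm_mul, Complex.norm_I, mul_one, Complex.norm_real]
      exact mul_le_mul_of_nonneg_right (hL j) (norm_nonneg _)
    · refine (norm_sum_le _ _).trans ?_
      calc _ ≤ ∑ _k : Fin m, 3 * L ^ 2 * c ^ 2 / m := by
            refine Finset.sum_le_sum fun k _ => ?_
            rw [norm_mul, Complex.norm_exp_ofReal_mul_I, one_mul]
            refine (norm_cexp_mul_I_sub_one_sub_le _).trans ?_
            have h1 : (d j * a k j) ^ 2 ≤ (L * (c / √m)) ^ 2 := by
              rw [← sq_abs, abs_mul]
              exact pow_le_pow_left₀ (by positivity)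
                (mul_le_mul (hL j) (hc k j) (abs_nonneg _) hL0) 2
            rw [mul_pow L, div_pow, Real.sq_sqrt hm'.le] at h1
            calc _ ≤ 3 * (L ^ 2 * (c ^ 2 / m)) := by linarith
              _ = _ := by ring
        _ = _ := by
            simp only [Finset.sum_const, Finset.card_univ, Fintype.card_fin, nsmul_eq_mul]
            field_simp
  calc _ ≤ ∑ j, ((m : ℝ)⁻¹ ^ 2 * (2 * L ^ 2 * ‖g j‖ ^ 2 + 18 * L ^ 4 * c ^ 4)) := by
        refine Finset.sum_le_sum fun j _ => ?_
        refine (pow_le_pow_left₀ (norm_nonneg _) (hterm j) 2).trans ?_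
        rw [mul_pow]
        refine mul_le_mul_of_nonneg_left ?_ (by positivity)
        nlinarith [sq_nonneg (L * ‖g j‖ - 3 * L ^ 2 * c ^ 2)]
    _ = (m : ℝ)⁻¹ ^ 2 * (2 * L ^ 2 * ∑ j, ‖g j‖ ^ 2 + m * (18 * L ^ 4 * c ^ 4)) := by
        rw [← Finset.mul_sum, Finset.sum_add_distrib, ← Finset.mul_sum]
        simp
    _ ≤ (m : ℝ)⁻¹ ^ 2 * (2 * L ^ 2 * (D * m) + m * (18 * L ^ 4 * c ^ 4)) := by
        gcongr
    _ = _ := by field_simp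

variable {Ω : Type*} [MeasurableSpace Ω] {P : Measure Ω} [IsProbabilityMeasure P]

theorem integral_norm_empiricalCharFun_sub_integral_pow_four_le {m : ℕ} (hm : 0 < m)
    {a : Fin m → Fin m → ℝ} {c D B : ℝ} (hc : ∀ k j, |a k j| ≤ c / √m) (hD0 : 0 ≤ D)
    (hD : ∀ z : Fin m → ℝ, ∑ k, (∑ j, z j * a k j) ^ 2 ≤ D * ∑ j, z j ^ 2)
    {X : Fin m → Ω → ℝ} (hX : ∀ j, Measurable (X j)) (hindep : iIndepFun X P)
    {τ : ℝ → ℝ} (hτ : Measurable τ) (hB : ∀ x, |τ x| ≤ B) :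
    ∫ ω, ‖empiricalCharFun a (fun j => τ (X j ω)) -
      ∫ ω', empiricalCharFun a (fun j => τ (X j ω')) ∂P‖ ^ 4 ∂P ≤
      16 * ((8 * B ^ 2 * D + 288 * B ^ 4 * c ^ 4) / m) ^ 2 := by
  set κ := (8 * B ^ 2 * D + 288 * B ^ 4 * c ^ 4) / m with hκ
  set μ : Fin m → Measure ℝ := fun j => P.map (X j) with hμ
  have : ∀ j, IsProbabilityMeasure (μ j) := fun j =>
    Measure.isProbabilityMeasure_map (hX j).aemeasurable
  set F : (Fin m → ℝ) → ℂ := fun x => empiricalCharFun a fun j => τ (x j) with hF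
  have hFm : Measurable F := (measurable_empiricalCharFun a).comp (by fun_prop)
  have hF1 : ∀ x, ‖F x‖ ≤ 1 := fun x => norm_empiricalCharFun_le _ _
  have hmap : P.map (fun ω j => X j ω) = Measure.pi μ :=
    hindep.map_fun_eq_pi_map fun j => (hX j).aemeasurable
  have hXm : Measurable fun ω j => X j ω := by fun_prop
  have hinc : ∀ x y : Fin m → ℝ,
      ∑ j, ‖F x - F (Function.update x j (y j))‖ ^ 2 ≤ κ := by
    intro x y
    have h := sum_norm_sq_empiricalCharFun_sub_update_le hm hc hD0 hD (fun j => τ (x j))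
      (fun j => τ (y j)) (L := 2 * B) fun j => by
        have := abs_sub (τ (y j)) (τ (x j)); have := hB (x j); have := hB (y j); linarith
    have hu : ∀ j, (fun i => τ (Function.update x j (y j) i)) =
        Function.update (fun i => τ (x i)) j (τ (y j)) := fun j => by
      funext i
      by_cases h : i = j
      · subst h; simp
      · simp [h]
    simp only [hF, hu]
    refine h.trans (le_of_eq ?_)
    rw [hκ]; ring
  have hFi : Integrable F (Measure.pi μ) :=
    Integrable.of_bound hFm.aestronglyMeasurable 1 (Eventually.of_forall hF1)
  set E := ∫ x, F x ∂Measure.pi μ with hE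
  have hEX : ∫ ω', empiricalCharFun a (fun j => τ (X j ω')) ∂P = E := by
    rw [hE, ← hmap, integral_map hXm.aemeasurable hFm.aestronglyMeasurable]
  have hre : ∫ x, (F x).re ∂Measure.pi μ = E.re := integral_re hFi
  have him : ∫ x, (F x).im ∂Measure.pi μ = E.im := integral_im hFi
  have h1 := integral_sub_integral_pow_four_le μ (G := fun x => (F x).re)
    (Complex.measurable_re.comp hFm) (C := 1)
    (fun x => (Complex.abs_re_le_norm _).trans (hF1 x)) (κ := κ) fun x y => by
      refine (Finset.sum_le_sum fun j _ => ?_).trans (hinc x y)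
      rw [← Complex.sub_re, ← sq_abs]
      exact pow_le_pow_left₀ (abs_nonneg _) (Complex.abs_re_le_norm _) 2
  have h2 := integral_sub_integral_pow_four_le μ (G := fun x => (F x).im)
    (Complex.measurable_im.comp hFm) (C := 1)
    (fun x => (Complex.abs_im_le_norm _).trans (hF1 x)) (κ := κ) fun x y => by
      refine (Finset.sum_le_sum fun j _ => ?_).trans (hinc x y)
      rw [← Complex.sub_im, ← sq_abs]
      exact pow_le_pow_left₀ (abs_nonneg _) (Complex.abs_im_le_norm _) 2
  rw [hre] at h1
  rw [him] at h2
  rw [hEX]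
  have hbd : ∀ x, ‖F x - E‖ ≤ 2 := fun x => by
    have hE1 : ‖E‖ ≤ 1 := by
      refine (norm_integral_le_of_norm_le_const (C := 1) (Eventually.of_forall hF1)).trans ?_
      simp
    have := norm_sub_le (F x) E; have := hF1 x; linarith
  have hch : ∫ ω, ‖empiricalCharFun a (fun j => τ (X j ω)) - E‖ ^ 4 ∂P =
      ∫ x, ‖F x - E‖ ^ 4 ∂Measure.pi μ := by
    rw [← hmap, integral_map hXm.aemeasurable
      ((hFm.sub_const E).norm.pow_const 4).aestronglyMeasurable]
  have i0 : ∀ f : (Fin m → ℝ) → ℝ, Measurable f → (∀ x, |f x| ≤ ‖F x - E‖) →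
      Integrable (fun x => f x ^ 4) (Measure.pi μ) := fun f hf hb =>
    Integrable.of_bound (hf.pow_const 4).aestronglyMeasurable (2 ^ 4)
      (Eventually.of_forall fun x => by
        rw [norm_pow, Real.norm_eq_abs]
        exact pow_le_pow_left₀ (abs_nonneg _) ((hb x).trans (hbd x)) 4)
  have i1 := i0 (fun x => (F x).re - E.re) ((Complex.measurable_re.comp hFm).sub_const _)
    fun x => by rw [← Complex.sub_re]; exact Complex.abs_re_le_norm _
  have i2 := i0 (fun x => (F x).im - E.im) ((Complex.measurable_im.comp hFm).sub_const _)
    fun x => by rw [← Complex.sub_im]; exact Complex.abs_im_le_norm _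
  have i3 := i0 (fun x => ‖F x - E‖) (hFm.sub_const E).norm fun x => by simp
  rw [hch]
  calc _ ≤ ∫ x, (2 * ((F x).re - E.re) ^ 4 + 2 * ((F x).im - E.im) ^ 4) ∂Measure.pi μ := by
        refine integral_mono i3 ((i1.const_mul 2).add (i2.const_mul 2)) fun x => ?_
        have : ‖F x - E‖ ^ 4 = (((F x).re - E.re) ^ 2 + ((F x).im - E.im) ^ 2) ^ 2 := by
          rw [show ‖F x - E‖ ^ 4 = (‖F x - E‖ ^ 2) ^ 2 by ring, ← Complex.normSq_eq_norm_sq,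
            Complex.normSq_apply, Complex.sub_re, Complex.sub_im]
          ring
        dsimp only
        rw [this]
        nlinarith [sq_nonneg (((F x).re - E.re) ^ 2 - ((F x).im - E.im) ^ 2)]
    _ ≤ _ := by
        rw [integral_add (i1.const_mul 2) (i2.const_mul 2), integral_const_mul, integral_const_mul]
        linarith

/-- Nonnegative functions with summable integrals tend to zero almost everywhere. -/
theorem ae_tendsto_zero_of_summable_integral {Ω : Type*} [MeasurableSpace Ω] {P : Measure Ω}
    {g : ℕ → Ω → ℝ} (h0 : ∀ n ω, 0 ≤ g n ω)
    (hi : ∀ n, Integrable (g n) P) {b : ℕ → ℝ} (hb : Summable b)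
    (hgb : ∀ n, ∫ ω, g n ω ∂P ≤ b n) :
    ∀ᵐ ω ∂P, Tendsto (fun n => g n ω) atTop (𝓝 0) := by
  have hs : Summable fun n => ∫ ω, g n ω ∂P :=
    hb.of_nonneg_of_le (fun n => integral_nonneg (h0 n)) hgb
  have hl : ∫⁻ ω, ∑' n, ENNReal.ofReal (g n ω) ∂P ≠ ⊤ := by
    rw [lintegral_tsum fun n => (hi n).aemeasurable.ennreal_ofReal]
    simp_rw [← ofReal_integral_eq_lintegral_ofReal (hi _) (Eventually.of_forall (h0 _))]
    exact hs.tsum_ofReal_ne_top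
  have hae := ae_lt_top' (AEMeasurable.tsum fun n => (hi n).aemeasurable.ennreal_ofReal) hl
  filter_upwards [hae] with ω hω
  have h := ENNReal.tendsto_atTop_zero_of_tsum_ne_top hω.ne
  have h2 := (ENNReal.tendsto_toReal ENNReal.zero_ne_top).comp h
  simpa [Function.comp_def, ENNReal.toReal_ofReal (h0 _ ω)] using h2

theorem ae_tendsto_empiricalCharFun_sub_integral {X : ℕ → Ω → ℝ} (hX : ∀ j, Measurable (X j))
    (hindep : iIndepFun X P) {a : (n : ℕ) → Fin (n + 1) → Fin (n + 1) → ℝ} {c D B : ℝ}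
    (hc : ∀ n k j, |a n k j| ≤ c / √((n + 1 : ℕ) : ℝ)) (hD0 : 0 ≤ D)
    (hD : ∀ n (z : Fin (n + 1) → ℝ), ∑ k, (∑ j, z j * a n k j) ^ 2 ≤ D * ∑ j, z j ^ 2)
    {τ : ℝ → ℝ} (hτ : Measurable τ) (hB : ∀ x, |τ x| ≤ B) :
    ∀ᵐ ω ∂P, Tendsto (fun n => empiricalCharFun (a n) (fun j => τ (X j ω)) -
      ∫ ω', empiricalCharFun (a n) (fun j => τ (X j ω')) ∂P) atTop (𝓝 0) := by
  set K := 8 * B ^ 2 * D + 288 * B ^ 4 * c ^ 4 with hK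
  have hmeas : ∀ n, Measurable fun ω => empiricalCharFun (a n) fun j => τ (X j ω) := fun n =>
    (measurable_empiricalCharFun _).comp
      (measurable_pi_lambda _ fun j => hτ.comp (hX j))
  have h := ae_tendsto_zero_of_summable_integral (P := P)
    (g := fun n ω => ‖empiricalCharFun (a n) (fun j => τ (X j ω)) -
      ∫ ω', empiricalCharFun (a n) (fun j => τ (X j ω')) ∂P‖ ^ 4)
    (b := fun n => 16 * K ^ 2 * (1 / ((n + 1 : ℕ) : ℝ) ^ 2))
    (fun n ω => by positivity)
    (fun n => by
      refine Integrable.of_bound (((hmeas n).sub_const _).norm.pow_const 4).aestronglyMeasurable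
        (2 ^ 4) (Eventually.of_forall fun ω => ?_)
      rw [norm_pow, norm_norm]
      refine pow_le_pow_left₀ (norm_nonneg _) ((norm_sub_le _ _).trans ?_) 4
      have h2 : ‖∫ ω', empiricalCharFun (a n) (fun j => τ (X j ω')) ∂P‖ ≤ 1 := by
        refine (norm_integral_le_of_norm_le_const (C := 1)
          (Eventually.of_forall fun ω => norm_empiricalCharFun_le _ _)).trans ?_
        simp
      have := norm_empiricalCharFun_le (a n) fun j => τ (X j ω)
      linarith)
    ((((summable_nat_add_iff 1).2 (Real.summable_one_div_nat_pow.2 one_lt_two))).mul_left _)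
    (fun n => by
      refine (integral_norm_empiricalCharFun_sub_integral_pow_four_le n.succ_pos (hc n) hD0 (hD n)
        (fun j => hX j) (hindep.precomp Fin.val_injective) hτ hB).trans (le_of_eq ?_)
      rw [div_pow]; ring)
  filter_upwards [h] with ω hω
  rw [tendsto_zero_iff_norm_tendsto_zero]
  have h3 := hω.sqrt.sqrt
  simp only [Real.sqrt_zero] at h3
  refine h3.congr fun n => ?_
  rw [show ∀ x : ℝ, x ^ 4 = (x ^ 2) ^ 2 from fun x => by ring, Real.sqrt_sq (by positivity),
    Real.sqrt_sq (norm_nonneg _)]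

end Concentration

section LawOfLargeNumbers

variable {Ω : Type*} [MeasurableSpace Ω] {P : Measure Ω} [IsProbabilityMeasure P]

theorem measureReal_lt_abs_le {X : Ω → ℝ} (hint : Integrable (fun ω => |X ω| ^ 3) P) {M : ℝ}
    (hM : ∫ ω, |X ω| ^ 3 ∂P ≤ M) {q : ℝ} (hq : 0 < q) :
    P {ω | q < |X ω|} ≤ ENNReal.ofReal (M / q ^ 3) := by
  have h := mul_meas_ge_le_integral_of_nonneg (μ := P) (f := fun ω => |X ω| ^ 3)
    (Eventually.of_forall fun ω => by positivity) hint (q ^ 3)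
  rw [← ofReal_measureReal]
  refine ENNReal.ofReal_le_ofReal ?_
  rw [le_div_iff₀ (by positivity), mul_comm]
  refine (mul_le_mul_of_nonneg_left (measureReal_mono fun ω hω => ?_) (by positivity)).trans
    (h.trans hM)
  exact pow_le_pow_left₀ hq.le (le_of_lt hω) 3

/-- The square of `x`, kept only for `B < |x| ≤ q`. -/
def sqBetween (B q x : ℝ) : ℝ := if B < |x| ∧ |x| ≤ q then x ^ 2 else 0

theorem measurable_sqBetween (B q : ℝ) : Measurable (sqBetween B q) := by
  refine Measurable.ite ?_ (by fun_prop) measurable_const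
  exact (measurableSet_lt measurable_const continuous_abs.measurable).inter
    (measurableSet_le continuous_abs.measurable measurable_const)

theorem sqBetween_nonneg (B q x : ℝ) : 0 ≤ sqBetween B q x := by
  unfold sqBetween; split_ifs <;> positivity

theorem sqBetween_le_sq (B q x : ℝ) : sqBetween B q x ≤ q ^ 2 := by
  unfold sqBetween
  split_ifs with h
  · rw [← sq_abs x]; exact pow_le_pow_left₀ (abs_nonneg _) h.2 2
  · positivity

theorem mul_sqBetween_le (B q x : ℝ) : B * sqBetween B q x ≤ |x| ^ 3 := by
  unfold sqBetween
  split_ifs with h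
  · rw [← sq_abs x]; nlinarith [mul_le_mul_of_nonneg_right h.1.le (sq_nonneg |x|)]
  · rw [mul_zero]; positivity

theorem sqBetween_sq_le (B : ℝ) {q : ℝ} (hq : 0 ≤ q) (x : ℝ) :
    sqBetween B q x ^ 2 ≤ q * |x| ^ 3 := by
  unfold sqBetween
  split_ifs with h
  · rw [← sq_abs x]; nlinarith [mul_le_mul_of_nonneg_right h.2 (pow_nonneg (abs_nonneg x) 3)]
  · rw [zero_pow two_ne_zero]; positivity

theorem memLp_sqBetween {X : Ω → ℝ} (hX : Measurable X) (B q : ℝ) :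
    MemLp (fun ω => sqBetween B q (X ω)) 2 P :=
  MemLp.of_bound ((measurable_sqBetween B q).comp hX).aestronglyMeasurable (q ^ 2)
    (Eventually.of_forall fun ω => by
      rw [Real.norm_eq_abs, abs_of_nonneg (sqBetween_nonneg _ _ _)]
      exact sqBetween_le_sq _ _ _)

theorem measure_sum_sqBetween_ge_le {X : ℕ → Ω → ℝ} (hX : ∀ j, Measurable (X j))
    (hindep : iIndepFun X P) (hint : ∀ j, Integrable (fun ω => |X j ω| ^ 3) P) {M : ℝ}
    (hM0 : 0 < M) (hM : ∀ j, ∫ ω, |X j ω| ^ 3 ∂P ≤ M) {B : ℝ} (hB : 0 < B) {q : ℝ} (hq : 0 < q)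
    {N : ℕ} (hN : (N : ℝ) = q ^ 2) :
    P {ω | 2 * (N * (M / B)) ≤ ∑ j ∈ Finset.range N, sqBetween B q (X j ω)} ≤
      ENNReal.ofReal (B ^ 2 / M / q) := by
  have hL : ∀ j, MemLp (fun ω => sqBetween B q (X j ω)) 2 P := fun j =>
    memLp_sqBetween (hX j) B q
  have hI : ∀ j, Integrable (fun ω => sqBetween B q (X j ω)) P := fun j =>
    (hL j).integrable (by norm_num)
  have hmean : ∫ ω, ∑ j ∈ Finset.range N, sqBetween B q (X j ω) ∂P ≤ N * (M / B) := by
    rw [integral_finsetSum _ fun j _ => hI j]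
    calc _ ≤ ∑ _j ∈ Finset.range N, M / B := by
          refine Finset.sum_le_sum fun j _ => ?_
          rw [le_div_iff₀ hB, mul_comm, ← integral_const_mul]
          exact (integral_mono ((hI j).const_mul B) (hint j)
            fun ω => mul_sqBetween_le B q _).trans (hM j)
      _ = _ := by simp
  have hvar : variance (fun ω => ∑ j ∈ Finset.range N, sqBetween B q (X j ω)) P ≤
      N * (q * M) := by
    have e : (fun ω => ∑ j ∈ Finset.range N, sqBetween B q (X j ω)) =
        ∑ j ∈ Finset.range N, fun ω => sqBetween B q (X j ω) := by
      ext ω; simp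
    rw [e, IndepFun.variance_sum (fun j _ => hL j) fun i _ j _ hij =>
      (hindep.indepFun hij).comp (measurable_sqBetween B q) (measurable_sqBetween B q)]
    calc _ ≤ ∑ _j ∈ Finset.range N, q * M := by
          refine Finset.sum_le_sum fun j _ => ?_
          refine (variance_le_expectation_sq (hL j).aestronglyMeasurable).trans ?_
          refine (integral_mono (hL j).integrable_sq ((hint j).const_mul q)
            fun ω => sqBetween_sq_le B hq.le _).trans ?_
          rw [integral_const_mul]
          exact mul_le_mul_of_nonneg_left (hM j) hq.le
      _ = _ := by simp
  have hT : MemLp (fun ω => ∑ j ∈ Finset.range N, sqBetween B q (X j ω)) 2 P :=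
    memLp_finsetSum _ fun j _ => hL j
  have hc : 0 < N * (M / B) := by rw [hN]; positivity
  have h := meas_ge_le_variance_div_sq hT hc
  refine (measure_mono fun ω hω => ?_).trans (h.trans (ENNReal.ofReal_le_ofReal ?_))
  · have hω' : 2 * (N * (M / B)) ≤ ∑ j ∈ Finset.range N, sqBetween B q (X j ω) := hω
    change N * (M / B) ≤ |_|
    refine le_trans ?_ (le_abs_self (_ : ℝ))
    linarith
  · calc _ ≤ N * (q * M) / (N * (M / B)) ^ 2 := by gcongr
      _ = _ := by rw [hN]; field_simp

theorem ae_eventually_sum_range_two_pow_le {X : ℕ → Ω → ℝ} (hX : ∀ j, Measurable (X j))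
    (hindep : iIndepFun X P) (hint : ∀ j, Integrable (fun ω => |X j ω| ^ 3) P) {M : ℝ}
    (hM0 : 0 < M) (hM : ∀ j, ∫ ω, |X j ω| ^ 3 ∂P ≤ M) {B : ℝ} (hB : 0 < B) :
    ∀ᵐ ω ∂P, ∀ᶠ k : ℕ in atTop, ∑ j ∈ Finset.range (2 ^ k),
      (if B < |X j ω| then X j ω ^ 2 else 0) ≤ 2 * (2 ^ k * (M / B)) := by
  have h2 : (0 : ℝ) < √2 := by positivity
  have hq : ∀ k : ℕ, 0 < √2 ^ k := fun k => by positivity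
  have hN : ∀ k : ℕ, ((2 ^ k : ℕ) : ℝ) = (√2 ^ k) ^ 2 := fun k => by
    rw [← pow_mul, mul_comm, pow_mul, Real.sq_sqrt zero_le_two]; simp
  have hgeom : Summable fun k : ℕ => (1 / √2) ^ k := by
    refine summable_geometric_of_lt_one (by positivity) ?_
    rw [div_lt_one h2, Real.lt_sqrt zero_le_one]; norm_num
  have s1 := ae_eventually_notMem (μ := P) (s := fun k : ℕ => {ω | 2 * ((2 ^ k : ℕ) * (M / B)) ≤
      ∑ j ∈ Finset.range (2 ^ k), sqBetween B (√2 ^ k) (X j ω)}) <| by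
    refine ne_top_of_le_ne_top ((hgeom.mul_left (B ^ 2 / M)).tsum_ofReal_ne_top)
      (ENNReal.tsum_le_tsum fun k => ?_)
    refine (measure_sum_sqBetween_ge_le hX hindep hint hM0 hM hB (hq k) (hN k)).trans (le_of_eq ?_)
    rw [div_pow, one_pow, mul_one_div]
  have s2 := ae_eventually_notMem (μ := P) (s := fun k : ℕ =>
      ⋃ j ∈ Finset.range (2 ^ k), {ω | √2 ^ k < |X j ω|}) <| by
    refine ne_top_of_le_ne_top ((hgeom.mul_left M).tsum_ofReal_ne_top)
      (ENNReal.tsum_le_tsum fun k => ?_)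
    refine (measure_biUnion_finset_le _ _).trans ((Finset.sum_le_sum fun j _ =>
      measureReal_lt_abs_le (hint j) (hM j) (hq k)).trans (le_of_eq ?_))
    rw [Finset.sum_const, Finset.card_range, nsmul_eq_mul, ← ENNReal.ofReal_natCast,
      ← ENNReal.ofReal_mul (by positivity), hN, div_pow, one_pow]
    congr 1
    have := hq k
    field_simp
  filter_upwards [s1, s2] with ω h1 h2'
  filter_upwards [h1, h2'] with k h3 h4
  have h5 : ∀ j ∈ Finset.range (2 ^ k), |X j ω| ≤ √2 ^ k := fun j hj => by
    by_contra hc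
    exact h4 (Set.mem_biUnion hj (lt_of_not_ge hc))
  have h6 : ∑ j ∈ Finset.range (2 ^ k), sqBetween B (√2 ^ k) (X j ω) <
      2 * ((2 ^ k : ℕ) * (M / B)) := lt_of_not_ge h3
  push_cast at h6
  refine le_trans (le_of_eq (Finset.sum_congr rfl fun j hj => ?_)) h6.le
  simp [sqBetween, h5 j hj]

theorem ae_eventually_sum_range_le {X : ℕ → Ω → ℝ} (hX : ∀ j, Measurable (X j))
    (hindep : iIndepFun X P) (hint : ∀ j, Integrable (fun ω => |X j ω| ^ 3) P) {M : ℝ}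
    (hM0 : 0 < M) (hM : ∀ j, ∫ ω, |X j ω| ^ 3 ∂P ≤ M) {B : ℝ} (hB : 0 < B) :
    ∀ᵐ ω ∂P, ∀ᶠ n : ℕ in atTop, ∑ j ∈ Finset.range n,
      (if B < |X j ω| then X j ω ^ 2 else 0) ≤ n * (4 * M / B) := by
  filter_upwards [ae_eventually_sum_range_two_pow_le hX hindep hint hM0 hM hB] with ω hω
  have hlog : Tendsto (fun n : ℕ => Nat.log 2 n + 1) atTop atTop :=
    tendsto_atTop_atTop.2 fun b => ⟨2 ^ b, fun n hn =>
      (Nat.le_log_of_pow_le one_lt_two hn).trans (Nat.le_succ _)⟩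
  filter_upwards [hlog.eventually hω, eventually_gt_atTop 0] with n hn hn0
  calc _ ≤ ∑ j ∈ Finset.range (2 ^ (Nat.log 2 n + 1)),
        (if B < |X j ω| then X j ω ^ 2 else 0) := by
        refine Finset.sum_le_sum_of_subset_of_nonneg
          (Finset.range_mono (Nat.lt_pow_succ_log_self one_lt_two n).le) fun j _ _ => ?_
        split_ifs <;> positivity
    _ ≤ 2 * (2 ^ (Nat.log 2 n + 1) * (M / B)) := hn
    _ ≤ 2 * ((2 * n) * (M / B)) := by
        have h1 : (2 : ℝ) ^ Nat.log 2 n ≤ n := by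
          exact_mod_cast Nat.pow_log_le_self 2 hn0.ne'
        have h2 : (2 : ℝ) ^ (Nat.log 2 n + 1) ≤ 2 * n := by rw [pow_succ]; linarith
        have h3 : 0 ≤ M / B := by positivity
        exact mul_le_mul_of_nonneg_left (mul_le_mul_of_nonneg_right h2 h3) zero_le_two
    _ = _ := by ring

end LawOfLargeNumbers

section EmpiricalConvergence

open scoped RealInnerProductSpace

theorem norm_cexp_mul_I_sub_cexp_mul_I_le (u v : ℝ) :
    ‖Complex.exp (u * Complex.I) - Complex.exp (v * Complex.I)‖ ≤ |u - v| := by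
  have e : Complex.exp (u * Complex.I) - Complex.exp (v * Complex.I) =
      Complex.exp (v * Complex.I) * (Complex.exp (Complex.I * ((u - v : ℝ) : ℂ)) - 1) := by
    rw [mul_sub, ← Complex.exp_add]; push_cast; ring_nf
  rw [e, norm_mul, Complex.norm_exp_ofReal_mul_I, one_mul]
  exact Real.norm_exp_I_mul_ofReal_sub_one_le

theorem norm_empiricalCharFun_sub_le {m : ℕ} (a b : Fin m → Fin m → ℝ) (x y : Fin m → ℝ) :
    ‖empiricalCharFun a x - empiricalCharFun b y‖ ≤
      (m : ℝ)⁻¹ * ∑ k, |∑ j, x j * a k j - ∑ j, y j * b k j| := by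
  rw [empiricalCharFun, empiricalCharFun, ← mul_sub, ← Finset.sum_sub_distrib, norm_mul,
    norm_inv, Complex.norm_natCast]
  exact mul_le_mul_of_nonneg_left ((norm_sum_le _ _).trans
    (Finset.sum_le_sum fun k _ => norm_cexp_mul_I_sub_cexp_mul_I_le _ _)) (by positivity)

theorem inv_mul_sum_le_of_sum_sq_le {m : ℕ} (hm : 0 < m) (f : Fin m → ℝ) {δ : ℝ} (hδ : 0 < δ) :
    (m : ℝ)⁻¹ * ∑ k, f k ≤ δ / 2 + (2 * δ)⁻¹ * ((m : ℝ)⁻¹ * ∑ k, f k ^ 2) := by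
  have h : ∀ k, f k ≤ δ / 2 + (2 * δ)⁻¹ * f k ^ 2 := fun k => by
    have e : δ / 2 + (2 * δ)⁻¹ * f k ^ 2 - f k = (2 * δ)⁻¹ * (f k - δ) ^ 2 := by
      field_simp; ring
    have : 0 ≤ (2 * δ)⁻¹ * (f k - δ) ^ 2 := by positivity
    linarith
  calc _ ≤ (m : ℝ)⁻¹ * ∑ k, (δ / 2 + (2 * δ)⁻¹ * f k ^ 2) :=
        mul_le_mul_of_nonneg_left (Finset.sum_le_sum fun k _ => h k) (by positivity)
    _ = _ := by
        rw [Finset.sum_add_distrib, ← Finset.mul_sum, mul_add]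
        simp only [Finset.sum_const, Finset.card_univ, Fintype.card_fin, nsmul_eq_mul]
        field_simp

theorem norm_empiricalCharFun_sub_le_of_sum_sq {m : ℕ} (hm : 0 < m) {a : Fin m → Fin m → ℝ}
    {D : ℝ} (hD : ∀ z : Fin m → ℝ, ∑ k, (∑ j, z j * a k j) ^ 2 ≤ D * ∑ j, z j ^ 2)
    (x y : Fin m → ℝ) {δ : ℝ} (hδ : 0 < δ) :
    ‖empiricalCharFun a x - empiricalCharFun a y‖ ≤
      δ / 2 + (2 * δ)⁻¹ * ((m : ℝ)⁻¹ * (D * ∑ j, (x j - y j) ^ 2)) := by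
  refine (norm_empiricalCharFun_sub_le a a x y).trans
    ((inv_mul_sum_le_of_sum_sq_le hm _ hδ).trans ?_)
  have h := hD fun j => x j - y j
  simp only [sub_mul, Finset.sum_sub_distrib] at h
  simp only [sq_abs]
  gcongr

/-- Truncation of `x` to `0` outside of `[-B, B]`. -/
def truncateAt (B x : ℝ) : ℝ := if B < |x| then 0 else x

theorem measurable_truncateAt (B : ℝ) : Measurable (truncateAt B) :=
  Measurable.ite (measurableSet_lt measurable_const continuous_abs.measurable)
    measurable_const measurable_id

theorem abs_truncateAt_le {B : ℝ} (hB : 0 ≤ B) (x : ℝ) : |truncateAt B x| ≤ B := by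
  unfold truncateAt
  split_ifs with h
  · simpa using hB
  · exact not_lt.1 h

theorem sub_truncateAt_sq (B x : ℝ) :
    (x - truncateAt B x) ^ 2 = if B < |x| then x ^ 2 else 0 := by
  unfold truncateAt
  split_ifs <;> simp

theorem mul_sub_truncateAt_sq_le (B x : ℝ) : B * (x - truncateAt B x) ^ 2 ≤ |x| ^ 3 := by
  rw [sub_truncateAt_sq]
  split_ifs with h
  · rw [← sq_abs x]; nlinarith [mul_le_mul_of_nonneg_right h.le (sq_nonneg |x|)]
  · rw [mul_zero]; positivity

variable {Ω : Type*} [MeasurableSpace Ω] {P : Measure Ω} [IsProbabilityMeasure P]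

theorem norm_integral_empiricalCharFun_sub_truncate_le {m : ℕ} (hm : 0 < m)
    {a : Fin m → Fin m → ℝ} {D : ℝ} (hD0 : 0 ≤ D)
    (hD : ∀ z : Fin m → ℝ, ∑ k, (∑ j, z j * a k j) ^ 2 ≤ D * ∑ j, z j ^ 2)
    {X : Fin m → Ω → ℝ} (hX : ∀ j, Measurable (X j))
    (hint : ∀ j, Integrable (fun ω => |X j ω| ^ 3) P) {M : ℝ}
    (hM : ∀ j, ∫ ω, |X j ω| ^ 3 ∂P ≤ M) {B δ : ℝ} (hB : 0 < B) (hδ : 0 < δ) :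
    ‖∫ ω, empiricalCharFun a (fun j => X j ω) ∂P -
      ∫ ω, empiricalCharFun a (fun j => truncateAt B (X j ω)) ∂P‖ ≤
      δ / 2 + (2 * δ)⁻¹ * (D * (M / B)) := by
  have hXt : ∀ j, Measurable fun ω => truncateAt B (X j ω) := fun j =>
    (measurable_truncateAt B).comp (hX j)
  have hi : ∀ Y : Fin m → Ω → ℝ, (∀ j, Measurable (Y j)) →
      Integrable (fun ω => empiricalCharFun a fun j => Y j ω) P := fun Y hY =>
    Integrable.of_bound ((measurable_empiricalCharFun a).comp
      (measurable_pi_lambda _ hY)).aestronglyMeasurable 1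
      (Eventually.of_forall fun ω => norm_empiricalCharFun_le _ _)
  have hiz : ∀ j, Integrable (fun ω => (X j ω - truncateAt B (X j ω)) ^ 2) P := fun j => by
    refine ((hint j).const_mul B⁻¹).mono' (((hX j).sub (hXt j)).pow_const 2).aestronglyMeasurable
      (Eventually.of_forall fun ω => ?_)
    rw [Real.norm_eq_abs, abs_of_nonneg (sq_nonneg _), le_inv_mul_iff₀ hB]
    exact mul_sub_truncateAt_sq_le B _
  have hz : ∀ j, ∫ ω, (X j ω - truncateAt B (X j ω)) ^ 2 ∂P ≤ M / B := fun j => by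
    rw [le_div_iff₀ hB, mul_comm, ← integral_const_mul]
    exact (integral_mono ((hiz j).const_mul B) (hint j)
      fun ω => mul_sub_truncateAt_sq_le B _).trans (hM j)
  have his : Integrable (fun ω => ∑ j, (X j ω - truncateAt B (X j ω)) ^ 2) P :=
    integrable_finsetSum _ fun j _ => hiz j
  rw [← integral_sub (hi X hX) (hi _ hXt)]
  have hi2 : Integrable (fun ω => (2 * δ)⁻¹ * ((m : ℝ)⁻¹ * (D *
      ∑ j, (X j ω - truncateAt B (X j ω)) ^ 2))) P :=
    ((his.const_mul D).const_mul _).const_mul _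
  refine (norm_integral_le_of_norm_le (g := fun ω => δ / 2 + (2 * δ)⁻¹ * ((m : ℝ)⁻¹ * (D *
      ∑ j, (X j ω - truncateAt B (X j ω)) ^ 2))) ((integrable_const (δ / 2)).add hi2)
    (Eventually.of_forall fun ω => norm_empiricalCharFun_sub_le_of_sum_sq hm hD _ _ hδ)).trans ?_
  have e : ∫ ω, (δ / 2 + (2 * δ)⁻¹ * ((m : ℝ)⁻¹ * (D *
      ∑ j, (X j ω - truncateAt B (X j ω)) ^ 2))) ∂P = δ / 2 + (2 * δ)⁻¹ * ((m : ℝ)⁻¹ * (D *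
      ∑ j, ∫ ω, (X j ω - truncateAt B (X j ω)) ^ 2 ∂P)) := by
    rw [integral_add (integrable_const _) hi2, integral_const_mul, integral_const_mul,
      integral_const_mul, integral_finsetSum _ fun j _ => hiz j]
    simp
  rw [e]
  have hm' : (0 : ℝ) < m := Nat.cast_pos.2 hm
  have h1 : ∑ j, ∫ ω, (X j ω - truncateAt B (X j ω)) ^ 2 ∂P ≤ m * (M / B) :=
    (Finset.sum_le_sum fun j _ => hz j).trans (by simp)
  have h2 : (m : ℝ)⁻¹ * (D * ∑ j, ∫ ω, (X j ω - truncateAt B (X j ω)) ^ 2 ∂P) ≤ D * (M / B) := by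
    rw [inv_mul_le_iff₀ hm']
    calc _ ≤ D * (m * (M / B)) := mul_le_mul_of_nonneg_left h1 hD0
      _ = _ := by ring
  gcongr

theorem ae_tendsto_empiricalCharFun {X : ℕ → Ω → ℝ} (hX : ∀ j, Measurable (X j))
    (hindep : iIndepFun X P) (hmean : ∀ j, ∫ ω, X j ω ∂P = 0)
    (hvar : ∀ j, ∫ ω, X j ω ^ 2 ∂P = 1)
    (hint : ∀ j, Integrable (fun ω => |X j ω| ^ 3) P) {M : ℝ} (hM0 : 0 < M)
    (hM : ∀ j, ∫ ω, |X j ω| ^ 3 ∂P ≤ M)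
    {a : (n : ℕ) → Fin (n + 1) → Fin (n + 1) → ℝ} {c D s : ℝ}
    (hc : ∀ n k j, |a n k j| ≤ c / √((n + 1 : ℕ) : ℝ)) (hD0 : 0 ≤ D)
    (hD : ∀ n (z : Fin (n + 1) → ℝ), ∑ k, (∑ j, z j * a n k j) ^ 2 ≤ D * ∑ j, z j ^ 2)
    (hs0 : 0 ≤ s) (hs : Tendsto (fun n => ((n + 1 : ℕ) : ℝ)⁻¹ * ∑ k, |∑ j, a n k j ^ 2 - s|)
      atTop (𝓝 0)) :
    ∀ᵐ ω ∂P, Tendsto (fun n => empiricalCharFun (a n) fun j => X j ω) atTop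
      (𝓝 (Real.exp (-(s / 2)) : ℝ)) := by
  have hEX : Tendsto (fun n => ∫ ω, empiricalCharFun (a n) (fun j => X j ω) ∂P -
      ((Real.exp (-(s / 2)) : ℝ) : ℂ)) atTop (𝓝 0) := by
    rw [tendsto_zero_iff_norm_tendsto_zero]
    have hlim : Tendsto (fun n : ℕ => (4 * M + 1) * c ^ 3 / √((n + 1 : ℕ) : ℝ) +
        ((n + 1 : ℕ) : ℝ)⁻¹ * ∑ k, |∑ j, a n k j ^ 2 - s|) atTop (𝓝 (0 + 0)) := by
      refine Tendsto.add (tendsto_const_nhds.div_atTop ?_) hs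
      exact Real.tendsto_sqrt_atTop.comp
        (tendsto_natCast_atTop_atTop.comp (tendsto_add_atTop_nat 1))
    rw [add_zero] at hlim
    refine squeeze_zero (fun _ => norm_nonneg _) (fun n => ?_) hlim
    exact norm_integral_empiricalCharFun_sub_le n.succ_pos (fun j => hX j)
      (hindep.precomp Fin.val_injective) (fun j => hmean j) (fun j => hvar j) (fun j => hint j)
      hM0.le (fun j => hM j) (a n) (hc n) hs0
  have h1 : ∀ᵐ ω ∂P, ∀ b : ℕ, Tendsto (fun n => empiricalCharFun (a n)
      (fun j => truncateAt (b + 1) (X j ω)) - ∫ ω', empiricalCharFun (a n)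
      (fun j => truncateAt (b + 1) (X j ω')) ∂P) atTop (𝓝 0) :=
    ae_all_iff.2 fun b => ae_tendsto_empiricalCharFun_sub_integral hX hindep hc hD0 hD
      (measurable_truncateAt _) (abs_truncateAt_le (by positivity))
  have h2 : ∀ᵐ ω ∂P, ∀ b : ℕ, ∀ᶠ n : ℕ in atTop, ∑ j ∈ Finset.range n,
      (if (b + 1 : ℝ) < |X j ω| then X j ω ^ 2 else 0) ≤ n * (4 * M / (b + 1 : ℝ)) :=
    ae_all_iff.2 fun b => ae_eventually_sum_range_le hX hindep hint hM0 hM (by positivity)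
  filter_upwards [h1, h2] with ω hω1 hω2
  rw [← tendsto_sub_nhds_zero_iff, Metric.tendsto_nhds]
  intro ε hε
  set δ := ε / 4 with hδ
  have hδ0 : 0 < δ := by positivity
  obtain ⟨b, hb⟩ := exists_nat_ge (4 * D * M / δ ^ 2)
  set B : ℝ := b + 1 with hB
  have hB0 : 0 < B := by positivity
  have hDB : D * (4 * M / B) ≤ δ ^ 2 := by
    rw [div_le_iff₀ (by positivity)] at hb
    rw [← mul_div_assoc, div_le_iff₀ hB0]
    nlinarith [sq_nonneg δ]
  have hδδ : (2 * δ)⁻¹ * δ ^ 2 = δ / 2 := by field_simp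
  have hDM : 0 ≤ D * (M / B) := by positivity
  filter_upwards [Metric.tendsto_nhds.1 hEX δ hδ0, Metric.tendsto_nhds.1 (hω1 b) δ hδ0,
    (tendsto_add_atTop_nat 1).eventually (hω2 b)] with n hn1 hn2 hn3
  rw [dist_zero_right] at hn1 hn2 ⊢
  have hn4 : ‖empiricalCharFun (a n) (fun j => X j ω) -
      empiricalCharFun (a n) (fun j => truncateAt B (X j ω))‖ ≤ δ := by
    refine (norm_empiricalCharFun_sub_le_of_sum_sq n.succ_pos (hD n) _ _ hδ0).trans ?_
    simp only [sub_truncateAt_sq]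
    rw [Fin.sum_univ_eq_sum_range (fun j => if B < |X j ω| then X j ω ^ 2 else 0)]
    have h5 : ((n + 1 : ℕ) : ℝ)⁻¹ * (D * ∑ j ∈ Finset.range (n + 1),
        (if B < |X j ω| then X j ω ^ 2 else 0)) ≤ δ ^ 2 := by
      rw [inv_mul_le_iff₀ (by positivity)]
      calc _ ≤ D * (((n + 1 : ℕ) : ℝ) * (4 * M / B)) := mul_le_mul_of_nonneg_left hn3 hD0
        _ = ((n + 1 : ℕ) : ℝ) * (D * (4 * M / B)) := by ring
        _ ≤ _ := by gcongr
    have h6 := mul_le_mul_of_nonneg_left h5 (by positivity : 0 ≤ (2 * δ)⁻¹)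
    rw [hδδ] at h6
    linarith
  have hn5 : ‖∫ ω, empiricalCharFun (a n) (fun j => X j ω) ∂P -
      ∫ ω, empiricalCharFun (a n) (fun j => truncateAt B (X j ω)) ∂P‖ ≤ δ := by
    refine (norm_integral_empiricalCharFun_sub_truncate_le n.succ_pos hD0 (hD n)
      (fun j => hX j) (fun j => hint j) (fun j => hM j) hB0 hδ0).trans ?_
    have h5 : D * (M / B) ≤ δ ^ 2 := by
      have : D * (4 * M / B) = 4 * (D * (M / B)) := by ring
      linarith
    have h6 := mul_le_mul_of_nonneg_left h5 (by positivity : 0 ≤ (2 * δ)⁻¹)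
    rw [hδδ] at h6
    linarith
  set p := empiricalCharFun (a n) fun j => X j ω
  set q := empiricalCharFun (a n) fun j => truncateAt B (X j ω)
  set u := ∫ ω, empiricalCharFun (a n) (fun j => X j ω) ∂P
  set v := ∫ ω, empiricalCharFun (a n) (fun j => truncateAt B (X j ω)) ∂P
  set L : ℂ := ((Real.exp (-(s / 2)) : ℝ) : ℂ)
  have e : p - L = (p - q) + (q - v) - (u - v) + (u - L) := by ring
  have h7 : ‖p - L‖ ≤ ‖p - q‖ + ‖q - v‖ + ‖u - v‖ + ‖u - L‖ := by
    rw [e]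
    exact (norm_add_le _ _).trans (add_le_add_left ((norm_sub_le _ _).trans
      (add_le_add_left (norm_add_le _ _) _)) _)
  linarith

theorem norm_empiricalCharFun_inner_sub_le {E : Type*} [NormedAddCommGroup E]
    [InnerProductSpace ℝ E] {m : ℕ} (hm : 0 < m) {v : Fin m → Fin m → E} {D : ℝ} (hD0 : 0 ≤ D)
    (hD : ∀ z : Fin m → ℝ, ∑ k, ‖∑ j, z j • v k j‖ ^ 2 ≤ D * ∑ j, z j ^ 2)
    (x : Fin m → ℝ) {C : ℝ} (hx : ∑ j, x j ^ 2 ≤ m * C) (θ θ' : E) :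
    ‖empiricalCharFun (fun k j => ⟪v k j, θ⟫) x - empiricalCharFun (fun k j => ⟪v k j, θ'⟫) x‖ ≤
      (1 / 2 + 1 / 2 * (D * C)) * ‖θ - θ'‖ := by
  have hm' : (0 : ℝ) < m := Nat.cast_pos.2 hm
  have hinner : ∀ k θ, ∑ j, x j * ⟪v k j, θ⟫ = ⟪∑ j, x j • v k j, θ⟫ := fun k θ => by
    simp [sum_inner, real_inner_smul_left]
  refine (norm_empiricalCharFun_sub_le _ _ _ _).trans ?_
  simp only [hinner, ← inner_sub_right]
  have h3 := inv_mul_sum_le_of_sum_sq_le hm (fun k => ‖∑ j, x j • v k j‖) one_pos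
  have h4 : (m : ℝ)⁻¹ * ∑ k, ‖∑ j, x j • v k j‖ ^ 2 ≤ D * C := by
    rw [inv_mul_le_iff₀ hm']
    calc _ ≤ D * ∑ j, x j ^ 2 := hD _
      _ ≤ D * (m * C) := mul_le_mul_of_nonneg_left hx hD0
      _ = _ := by ring
  calc _ ≤ (m : ℝ)⁻¹ * ∑ k, ‖∑ j, x j • v k j‖ * ‖θ - θ'‖ := by
        refine mul_le_mul_of_nonneg_left (Finset.sum_le_sum fun k _ => ?_) (by positivity)
        exact abs_real_inner_le_norm _ _
    _ = ((m : ℝ)⁻¹ * ∑ k, ‖∑ j, x j • v k j‖) * ‖θ - θ'‖ := by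
        rw [← Finset.sum_mul, mul_assoc]
    _ ≤ _ := by
        refine mul_le_mul_of_nonneg_right (h3.trans ?_) (norm_nonneg _)
        linarith

theorem ae_forall_tendsto_empiricalCharFun {E : Type*} [NormedAddCommGroup E]
    [InnerProductSpace ℝ E] [SecondCountableTopology E]
    {X : ℕ → Ω → ℝ} (hX : ∀ j, Measurable (X j))
    (hindep : iIndepFun X P) (hmean : ∀ j, ∫ ω, X j ω ∂P = 0)
    (hvar : ∀ j, ∫ ω, X j ω ^ 2 ∂P = 1)
    (hint : ∀ j, Integrable (fun ω => |X j ω| ^ 3) P) {M : ℝ} (hM0 : 0 < M)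
    (hM : ∀ j, ∫ ω, |X j ω| ^ 3 ∂P ≤ M)
    {v : (n : ℕ) → Fin (n + 1) → Fin (n + 1) → E} {c D s : ℝ}
    (hc : ∀ n k j, ‖v n k j‖ ≤ c / √((n + 1 : ℕ) : ℝ)) (hD0 : 0 ≤ D)
    (hD : ∀ n (z : Fin (n + 1) → ℝ), ∑ k, ‖∑ j, z j • v n k j‖ ^ 2 ≤ D * ∑ j, z j ^ 2)
    (hs0 : 0 ≤ s) (hs : ∀ θ : E, Tendsto (fun n => ((n + 1 : ℕ) : ℝ)⁻¹ *
      ∑ k, |∑ j, ⟪v n k j, θ⟫ ^ 2 - s * ‖θ‖ ^ 2|) atTop (𝓝 0)) :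
    ∀ᵐ ω ∂P, ∀ θ : E, Tendsto
      (fun n => empiricalCharFun (fun k j => ⟪v n k j, θ⟫) fun j => X j ω) atTop
      (𝓝 (Real.exp (-(s * ‖θ‖ ^ 2 / 2)) : ℝ)) := by
  have hinner : ∀ n k (z : Fin (n + 1) → ℝ) θ,
      ∑ j, z j * ⟪v n k j, θ⟫ = ⟪∑ j, z j • v n k j, θ⟫ := fun n k z θ => by
    simp [sum_inner, real_inner_smul_left]
  have h1 : ∀ᵐ ω ∂P, ∀ i : ℕ, Tendsto
      (fun n => empiricalCharFun (fun k j => ⟪v n k j, TopologicalSpace.denseSeq E i⟫)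
        fun j => X j ω) atTop
      (𝓝 (Real.exp (-(s * ‖TopologicalSpace.denseSeq E i‖ ^ 2 / 2)) : ℝ)) := by
    refine ae_all_iff.2 fun i => ?_
    set θ := TopologicalSpace.denseSeq E i
    refine ae_tendsto_empiricalCharFun hX hindep hmean hvar hint hM0 hM (c := c * ‖θ‖)
      (D := D * ‖θ‖ ^ 2) (fun n k j => ?_) (by positivity) (fun n z => ?_) (by positivity) (hs θ)
    · refine (abs_real_inner_le_norm _ _).trans ?_
      rw [mul_div_right_comm]
      exact mul_le_mul_of_nonneg_right (hc n k j) (norm_nonneg _)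
    · calc _ ≤ ∑ k, ‖∑ j, z j • v n k j‖ ^ 2 * ‖θ‖ ^ 2 := by
            refine Finset.sum_le_sum fun k _ => ?_
            rw [hinner, ← sq_abs, ← mul_pow]
            exact pow_le_pow_left₀ (abs_nonneg _) (abs_real_inner_le_norm _ _) 2
        _ ≤ _ := by
            rw [← Finset.sum_mul, mul_right_comm]
            exact mul_le_mul_of_nonneg_right (hD n z) (by positivity)
  filter_upwards [h1, ae_eventually_sum_range_le hX hindep hint hM0 hM one_pos] with ω hω1 hω2
  intro θ
  set K := 1 / 2 + 1 / 2 * (D * (1 + 4 * M)) with hK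
  have hK0 : 0 < K := by positivity
  have hequi : ∀ᶠ n in atTop, ∀ θ' : E,
      ‖empiricalCharFun (fun k j => ⟪v n k j, θ⟫) (fun j => X j ω) -
        empiricalCharFun (fun k j => ⟪v n k j, θ'⟫) (fun j => X j ω)‖ ≤ K * ‖θ - θ'‖ := by
    filter_upwards [(tendsto_add_atTop_nat 1).eventually hω2] with n hn θ'
    have h2 : ∑ j : Fin (n + 1), X j ω ^ 2 ≤ ((n + 1 : ℕ) : ℝ) * (1 + 4 * M) := by
      rw [Fin.sum_univ_eq_sum_range (fun j => X j ω ^ 2)]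
      calc _ ≤ ∑ j ∈ Finset.range (n + 1),
            (1 + if 1 < |X j ω| then X j ω ^ 2 else 0) := by
            refine Finset.sum_le_sum fun j _ => ?_
            split_ifs with h
            · linarith
            · rw [add_zero, ← sq_abs]
              exact pow_le_one₀ (abs_nonneg _) (not_lt.1 h)
        _ ≤ _ := by
            rw [Finset.sum_add_distrib]
            simp only [div_one] at hn
            simp only [Finset.sum_const, Finset.card_range, nsmul_eq_mul, mul_one]
            linarith
    exact norm_empiricalCharFun_inner_sub_le n.succ_pos hD0 (hD n) _ h2 θ θ'
  have hcont : Continuous fun θ : E => ((Real.exp (-(s * ‖θ‖ ^ 2 / 2)) : ℝ) : ℂ) := by fun_prop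
  rw [Metric.tendsto_nhds]
  intro ε hε
  have hev : ∀ᶠ θ' in 𝓝 θ, dist ((Real.exp (-(s * ‖θ'‖ ^ 2 / 2)) : ℝ) : ℂ)
      ((Real.exp (-(s * ‖θ‖ ^ 2 / 2)) : ℝ) : ℂ) < ε / 3 ∧ K * ‖θ - θ'‖ < ε / 3 := by
    refine (Metric.tendsto_nhds.1 (hcont.tendsto θ) _ (by positivity)).and ?_
    have : Tendsto (fun θ' => K * ‖θ - θ'‖) (𝓝 θ) (𝓝 (K * ‖θ - θ‖)) :=
      (by fun_prop : Continuous fun θ' => K * ‖θ - θ'‖).tendsto θ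
    rw [sub_self, norm_zero, mul_zero] at this
    exact this.eventually (gt_mem_nhds (by positivity))
  obtain ⟨i, hi⟩ : ∃ i, TopologicalSpace.denseSeq E i ∈ {θ' | dist
      ((Real.exp (-(s * ‖θ'‖ ^ 2 / 2)) : ℝ) : ℂ)
      ((Real.exp (-(s * ‖θ‖ ^ 2 / 2)) : ℝ) : ℂ) < ε / 3 ∧ K * ‖θ - θ'‖ < ε / 3} := by
    obtain ⟨x, hx, i, rfl⟩ := mem_closure_iff_nhds.1
      (TopologicalSpace.denseRange_denseSeq E θ) _ hev
    exact ⟨i, hx⟩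
  filter_upwards [hequi, Metric.tendsto_nhds.1 (hω1 i) (ε / 3) (by positivity)] with n hn1 hn2
  have h5 := hn1 (TopologicalSpace.denseSeq E i)
  rw [← dist_eq_norm] at h5
  have h6 := dist_triangle4 (empiricalCharFun (fun k j => ⟪v n k j, θ⟫) fun j => X j ω)
    (empiricalCharFun (fun k j => ⟪v n k j, TopologicalSpace.denseSeq E i⟫) fun j => X j ω)
    ((Real.exp (-(s * ‖TopologicalSpace.denseSeq E i‖ ^ 2 / 2)) : ℝ) : ℂ)
    ((Real.exp (-(s * ‖θ‖ ^ 2 / 2)) : ℝ) : ℂ)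
  have := hi.1
  have := hi.2
  linarith

end EmpiricalConvergence

section PowerSums

theorem Matrix.IsHermitian.trace_pow_eq_sum_eigenvalues_pow {n : Type*} [Fintype n]
    [DecidableEq n] {A : Matrix n n ℝ} (hA : A.IsHermitian) (m : ℕ) :
    (A ^ m).trace = ∑ i, hA.eigenvalues i ^ m := by
  conv_lhs => rw [hA.spectral_theorem, ← map_pow, Unitary.conjStarAlgAut_apply,
    Matrix.trace_mul_cycle, Unitary.coe_star_mul_self, one_mul, Matrix.diagonal_pow,
    Matrix.trace_diagonal]
  rfl

theorem sum_cos_eq_of_sum_pow_eq {ι κ : Type*} {S : Finset ι} {T : Finset κ} {x : ι → ℝ}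
    {y : κ → ℝ} (h : ∀ m, ∑ i ∈ S, x i ^ (2 * m) = ∑ k ∈ T, y k ^ (2 * m)) (t : ℝ) :
    ∑ i ∈ S, Real.cos (t * x i) = ∑ k ∈ T, Real.cos (t * y k) := by
  refine (hasSum_sum fun i _ => Real.hasSum_cos (t * x i)).unique ?_
  convert! hasSum_sum fun k (_ : k ∈ T) => Real.hasSum_cos (t * y k) using 2 with m
  simp_rw [mul_pow, ← Finset.sum_div, ← Finset.mul_sum, h]

theorem sum_sin_eq_of_sum_pow_eq {ι κ : Type*} {S : Finset ι} {T : Finset κ} {x : ι → ℝ}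
    {y : κ → ℝ} (h : ∀ m, ∑ i ∈ S, x i ^ (2 * m + 1) = ∑ k ∈ T, y k ^ (2 * m + 1)) (t : ℝ) :
    ∑ i ∈ S, Real.sin (t * x i) = ∑ k ∈ T, Real.sin (t * y k) := by
  refine (hasSum_sum fun i _ => Real.hasSum_sin (t * x i)).unique ?_
  convert! hasSum_sum fun k (_ : k ∈ T) => Real.hasSum_sin (t * y k) using 2 with m
  simp_rw [mul_pow, ← Finset.sum_div, ← Finset.mul_sum, h]

end PowerSums

section Fourier

open ZMod (stdAddChar)
open scoped ComplexConjugate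

variable {N : ℕ} [NeZero N]

theorem norm_stdAddChar (a : ZMod N) : ‖stdAddChar a‖ = 1 := AddChar.norm_apply _ _

theorem stdAddChar_neg (a : ZMod N) : stdAddChar (-a) = conj (stdAddChar a) :=
  AddChar.map_neg_eq_conj _ _

theorem sum_stdAddChar_mul (b : ZMod N) :
    ∑ d, stdAddChar (d * b) = if b = 0 then (N : ℂ) else 0 := by
  rw [AddChar.sum_mulShift b (ZMod.isPrimitive_stdAddChar N), ZMod.card]
  split_ifs <;> simp

/-- The discrete Fourier transform of a real sequence, with the positive sign in the exponent. -/
def fourierSum (y : ZMod N → ℝ) (k : ZMod N) : ℂ := ∑ d, (y d : ℂ) * stdAddChar (d * k)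

theorem fourierSum_neg (y : ZMod N → ℝ) (k : ZMod N) :
    fourierSum y (-k) = conj (fourierSum y k) := by
  simp [fourierSum, mul_neg, stdAddChar_neg, map_sum]

theorem fourierSum_re (y : ZMod N → ℝ) (k : ZMod N) :
    (fourierSum y k).re = ∑ d, y d * (stdAddChar (d * k)).re := by
  simp [fourierSum]

/-- **Parseval's identity** for real sequences on `ZMod N`. -/
theorem sum_norm_fourierSum_sq (y : ZMod N → ℝ) :
    ∑ k, ‖fourierSum y k‖ ^ 2 = N * ∑ d, y d ^ 2 := by
  have h : ∀ k, ((‖fourierSum y k‖ ^ 2 : ℝ) : ℂ) =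
      ∑ d, ∑ d', (y d : ℂ) * y d' * stdAddChar (k * (d - d')) := by
    intro k
    rw [Complex.ofReal_pow, ← Complex.mul_conj', ← fourierSum_neg, fourierSum, fourierSum,
      Finset.sum_mul_sum]
    refine Finset.sum_congr rfl fun d _ => Finset.sum_congr rfl fun d' _ => ?_
    rw [show k * (d - d') = d * k + d' * -k by ring, AddChar.map_add_eq_mul]
    ring
  have h2 : ((∑ k, ‖fourierSum y k‖ ^ 2 : ℝ) : ℂ) = ((N * ∑ d, y d ^ 2 : ℝ) : ℂ) := by
    rw [Complex.ofReal_sum]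
    simp_rw [h]
    rw [Finset.sum_comm]
    simp_rw [Finset.sum_comm (s := Finset.univ (α := ZMod N)) (t := Finset.univ (α := ZMod N))
      (f := fun k d' => _ * stdAddChar (k * (_ - d')))]
    simp_rw [← Finset.mul_sum, sum_stdAddChar_mul, sub_eq_zero]
    simp [Finset.mul_sum]
    refine Finset.sum_congr rfl fun d _ => by ring
  exact_mod_cast h2

/-- The matrix of the discrete Fourier transform on `ZMod N`. -/
def fourierMatrix (N : ℕ) [NeZero N] : Matrix (ZMod N) (ZMod N) ℂ :=
  Matrix.of fun i k => stdAddChar (i * k)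

theorem fourierMatrix_mul_inverse :
    fourierMatrix N * ((N : ℂ)⁻¹ • Matrix.of fun k i => stdAddChar (-(k * i))) = 1 := by
  ext i j
  have h : ∀ k : ZMod N, stdAddChar (i * k) * stdAddChar (-(k * j)) =
      stdAddChar (k * (i - j)) := fun k => by
    rw [← AddChar.map_add_eq_mul]; ring_nf
  rw [Matrix.mul_smul, Matrix.smul_apply, Matrix.mul_apply]
  simp only [fourierMatrix, Matrix.of_apply, h, sum_stdAddChar_mul, sub_eq_zero, smul_eq_mul,
    Matrix.one_apply]
  split_ifs <;> simp [NeZero.ne N]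

theorem trace_pow_eq_of_mul_fourierMatrix_eq {A Q : Matrix (ZMod N) (ZMod N) ℂ}
    (h : A * fourierMatrix N = fourierMatrix N * Q) (m : ℕ) : (A ^ m).trace = (Q ^ m).trace := by
  set G : Matrix (ZMod N) (ZMod N) ℂ := (N : ℂ)⁻¹ • Matrix.of fun k i => stdAddChar (-(k * i))
  have h1 : fourierMatrix N * G = 1 := fourierMatrix_mul_inverse
  have h2 : G * fourierMatrix N = 1 := mul_eq_one_comm.1 h1
  have h3 : ∀ m, A ^ m * fourierMatrix N = fourierMatrix N * Q ^ m := by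
    intro m
    induction m with
    | zero => simp
    | succ m ih => rw [pow_succ, mul_assoc, h, ← mul_assoc, ih, mul_assoc, ← pow_succ]
  calc (A ^ m).trace = (A ^ m * fourierMatrix N * G).trace := by rw [mul_assoc, h1, mul_one]
    _ = (fourierMatrix N * Q ^ m * G).trace := by rw [h3]
    _ = (Q ^ m).trace := by rw [Matrix.trace_mul_cycle, h2, one_mul]

theorem trace_ofReal_pow (A : Matrix (ZMod N) (ZMod N) ℝ) (m : ℕ) :
    ((A.map ((↑) : ℝ → ℂ)) ^ m).trace = ((A ^ m).trace : ℂ) := by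
  have : (A.map ((↑) : ℝ → ℂ)) ^ m = (A ^ m).map ((↑) : ℝ → ℂ) :=
    (Matrix.map_pow A m (f := Complex.ofRealHom)).symm
  rw [this]
  simp [Matrix.trace]

theorem trace_circulant_pow (y : ZMod N → ℝ) (hy : ∀ d, y (-d) = y d) (m : ℕ) :
    ((Matrix.of fun i j => y (i - j)) ^ m).trace = ∑ k, (fourierSum y k).re ^ m := by
  have hreal : ∀ k, fourierSum y k = ((fourierSum y k).re : ℂ) := fun k => by
    rw [eq_comm, ← Complex.conj_eq_iff_re, ← fourierSum_neg, fourierSum, fourierSum]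
    refine Fintype.sum_equiv (Equiv.neg _) _ _ fun d => ?_
    simp [hy]
  have hAF : (Matrix.of fun i j => y (i - j)).map ((↑) : ℝ → ℂ) * fourierMatrix N =
      fourierMatrix N * Matrix.diagonal fun k => ((fourierSum y k).re : ℂ) := by
    ext i k
    rw [Matrix.mul_diagonal, ← hreal, Matrix.mul_apply, fourierSum, Finset.mul_sum]
    refine Fintype.sum_equiv ((Equiv.subRight i)) _ _ fun j => ?_
    simp only [Matrix.map_apply, Matrix.of_apply, fourierMatrix, Equiv.subRight_apply]
    rw [← hy (i - j), neg_sub, mul_left_comm, ← AddChar.map_add_eq_mul]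
    ring_nf
  have h := trace_pow_eq_of_mul_fourierMatrix_eq hAF m
  rw [trace_ofReal_pow, Matrix.diagonal_pow, Matrix.trace_diagonal] at h
  simp only [Pi.pow_apply] at h
  exact_mod_cast h

/-- The matrix of a reverse circulant matrix in the Fourier basis. -/
def reverseCirculantSymbol (y : ZMod N → ℝ) : Matrix (ZMod N) (ZMod N) ℂ :=
  Matrix.of fun l k => if l = -k then fourierSum y k else 0

theorem reverseCirculant_mul_fourierMatrix (y : ZMod N → ℝ) :
    (Matrix.of fun i j => y (i + j)).map ((↑) : ℝ → ℂ) * fourierMatrix N =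
      fourierMatrix N * reverseCirculantSymbol y := by
  ext i k
  rw [Matrix.mul_apply, Matrix.mul_apply]
  simp only [reverseCirculantSymbol, Matrix.of_apply, mul_ite, mul_zero, Finset.sum_ite_eq',
    Finset.mem_univ, if_true]
  rw [fourierSum, Finset.mul_sum]
  refine Fintype.sum_equiv (Equiv.addLeft i) _ _ fun j => ?_
  simp only [Matrix.map_apply, Matrix.of_apply, fourierMatrix, Equiv.coe_addLeft]
  rw [mul_left_comm, ← AddChar.map_add_eq_mul]
  ring_nf

theorem reverseCirculantSymbol_pow_two_mul (y : ZMod N → ℝ) (m : ℕ) :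
    reverseCirculantSymbol y ^ (2 * m) =
      Matrix.diagonal fun k => ((‖fourierSum y k‖ ^ (2 * m) : ℝ) : ℂ) := by
  have h : reverseCirculantSymbol y ^ 2 =
      Matrix.diagonal fun k => ((‖fourierSum y k‖ ^ 2 : ℝ) : ℂ) := by
    ext l k
    rw [sq, Matrix.mul_apply]
    simp only [reverseCirculantSymbol, Matrix.of_apply, mul_ite, mul_zero, Finset.sum_ite_eq',
      Finset.mem_univ, if_true, neg_neg, Matrix.diagonal_apply]
    split_ifs with hlk
    · subst hlk
      rw [fourierSum_neg, Complex.conj_mul', Complex.ofReal_pow]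
    · simp
  rw [pow_mul, h, Matrix.diagonal_pow]
  congr 1
  ext k
  simp [pow_mul]

theorem trace_reverseCirculant_pow_two_mul (y : ZMod N → ℝ) (m : ℕ) :
    ((Matrix.of fun i j => y (i + j)) ^ (2 * m)).trace = ∑ k, ‖fourierSum y k‖ ^ (2 * m) := by
  have h := trace_pow_eq_of_mul_fourierMatrix_eq (reverseCirculant_mul_fourierMatrix y) (2 * m)
  rw [trace_ofReal_pow, reverseCirculantSymbol_pow_two_mul, Matrix.trace_diagonal] at h
  exact_mod_cast h

theorem trace_reverseCirculant_pow_two_mul_add_one (y : ZMod N → ℝ) (m : ℕ) :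
    ((Matrix.of fun i j => y (i + j)) ^ (2 * m + 1)).trace =
      ∑ k with k = -k, (fourierSum y k).re ^ (2 * m + 1) := by
  have h := trace_pow_eq_of_mul_fourierMatrix_eq (reverseCirculant_mul_fourierMatrix y)
    (2 * m + 1)
  rw [trace_ofReal_pow, pow_succ' (reverseCirculantSymbol y), reverseCirculantSymbol_pow_two_mul] at h
  have htr : ∀ d : ZMod N → ℂ, (reverseCirculantSymbol y * Matrix.diagonal d).trace =
      ∑ k with k = -k, fourierSum y k * d k := fun d => by
    simp [Matrix.trace, Matrix.mul_diagonal, reverseCirculantSymbol, Finset.sum_filter]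
  rw [htr] at h
  have h2 : ∀ k ∈ Finset.univ.filter (fun k : ZMod N => k = -k),
      fourierSum y k * ((‖fourierSum y k‖ ^ (2 * m) : ℝ) : ℂ) =
        (((fourierSum y k).re ^ (2 * m + 1) : ℝ) : ℂ) := by
    intro k hk
    have hk' : k = -k := by simpa using hk
    have hr : ((fourierSum y k).re : ℂ) = fourierSum y k := by
      rw [← Complex.conj_eq_iff_re, ← fourierSum_neg, ← hk']
    have hn : ‖fourierSum y k‖ = |(fourierSum y k).re| := by
      rw [← Real.norm_eq_abs, ← Complex.norm_real, hr]
    rw [hn, pow_mul, sq_abs, ← pow_mul, pow_succ', Complex.ofReal_mul, hr]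
  rw [Finset.sum_congr rfl h2] at h
  exact_mod_cast h

theorem card_filter_eq_neg_le : (Finset.univ.filter fun k : ZMod N => k = -k).card ≤ 2 := by
  have h : (Finset.univ.filter fun k : ZMod N => k = -k) ⊆ {0, ((N / 2 : ℕ) : ZMod N)} := by
    intro k hk
    have hk' : -k = k := by simpa using (Finset.mem_filter.1 hk).2.symm
    rw [Finset.mem_insert, Finset.mem_singleton]
    refine ((ZMod.neg_eq_self_iff k).1 hk').imp id fun h => ?_
    rw [← ZMod.natCast_rightInverse k]
    congr 1
    omega
  exact (Finset.card_le_card h).trans Finset.card_le_two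

end Fourier

section EmpiricalMeasure

open scoped RealInnerProductSpace

variable {E : Type*} [MeasurableSpace E]

/-- The uniform distribution on a finite family of points, counted with multiplicity. -/
def empiricalMeasure {m : ℕ} [NeZero m] (p : Fin m → E) : ProbabilityMeasure E :=
  ⟨(m : ENNReal)⁻¹ • ∑ i : Fin m, Measure.dirac (p i), ⟨by
    simp [ENNReal.inv_mul_cancel (a := (m : ENNReal)) (by simp [NeZero.ne m]) (by simp)]⟩⟩

theorem spectralDistribution_eq_empiricalMeasure {n : ℕ} [NeZero n]
    (A : Matrix (Fin n) (Fin n) ℝ) (hA : A.IsHermitian) :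
    spectralDistribution A hA = empiricalMeasure hA.eigenvalues := rfl

theorem integral_empiricalMeasure [MeasurableSingletonClass E] {F : Type*}
    [NormedAddCommGroup F] [NormedSpace ℝ F] [CompleteSpace F] {m : ℕ} [NeZero m]
    (p : Fin m → E) (f : E → F) :
    ∫ x, f x ∂(empiricalMeasure p : Measure E) = (m : ℝ)⁻¹ • ∑ i, f (p i) := by
  have h : (empiricalMeasure p : Measure E) =
    (m : ENNReal)⁻¹ • ∑ i : Fin m, Measure.dirac (p i) := rfl
  rw [h, integral_smul_measure, integral_finsetSum_measure]
  · simp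
  · exact fun i _ => integrable_dirac (by simp)

theorem charFun_empiricalMeasure [MeasurableSingletonClass E] [NormedAddCommGroup E]
    [InnerProductSpace ℝ E] {m : ℕ} [NeZero m] (p : Fin m → E) (θ : E) :
    charFun (empiricalMeasure p : Measure E) θ =
      (m : ℂ)⁻¹ * ∑ i, Complex.exp ((⟪p i, θ⟫ : ℝ) * Complex.I) := by
  rw [charFun_apply, integral_empiricalMeasure]
  simp [Complex.real_smul]

end EmpiricalMeasure

section ComplexGaussian

open scoped RealInnerProductSpace

theorem integral_cexp_inner_mul_gaussian (θ : ℂ) :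
    ∫ z : ℂ, Complex.exp ((⟪z, θ⟫ : ℝ) * Complex.I) * (Real.exp (-‖z‖ ^ 2) / Real.pi : ℝ) =
      (Real.exp (-(1 / 2 * ‖θ‖ ^ 2 / 2)) : ℝ) := by
  have h := GaussianFourier.integral_cexp_neg_mul_sq_norm_add (b := 1) (V := ℂ) (by simp)
    Complex.I θ
  have e : ∀ z : ℂ, Complex.exp ((⟪z, θ⟫ : ℝ) * Complex.I) *
      (Real.exp (-‖z‖ ^ 2) / Real.pi : ℝ) =
      (Real.pi : ℂ)⁻¹ * Complex.exp (-1 * ‖z‖ ^ 2 + Complex.I * ((⟪θ, z⟫ : ℝ) : ℂ)) := fun z => by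
    rw [Complex.exp_add, real_inner_comm]
    push_cast
    rw [mul_comm Complex.I, neg_one_mul]
    ring
  simp_rw [e]
  rw [integral_const_mul, h, Complex.finrank_real_complex]
  norm_num
  congr 1
  ring

theorem integral_rexp_neg_norm_sq_div_pi :
    ∫ z : ℂ, Real.exp (-‖z‖ ^ 2) / Real.pi = 1 := by
  have h := GaussianFourier.integral_rexp_neg_mul_sq_norm (b := 1) (V := ℂ) one_pos
  rw [Complex.finrank_real_complex] at h
  rw [integral_div]
  norm_num at h
  rw [h, div_self Real.pi_ne_zero]

/-- The law on `ℂ` with density `exp (-‖z‖ ^ 2) / π`. -/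
def standardComplexNormal : ProbabilityMeasure ℂ :=
  ⟨volume.withDensity fun z : ℂ => ENNReal.ofReal (Real.exp (-‖z‖ ^ 2) / Real.pi), ⟨by
    have hi : Integrable fun z : ℂ => Real.exp (-‖z‖ ^ 2) / Real.pi := by
      by_contra hc
      have := integral_rexp_neg_norm_sq_div_pi
      rw [integral_undef hc] at this
      norm_num at this
    rw [withDensity_apply _ MeasurableSet.univ, Measure.restrict_univ,
      ← ofReal_integral_eq_lintegral_ofReal hi
        (Eventually.of_forall fun z => by have := Real.pi_pos; positivity),
      integral_rexp_neg_norm_sq_div_pi, ENNReal.ofReal_one]⟩⟩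

theorem integral_standardComplexNormal {F : Type*} [NormedAddCommGroup F] [NormedSpace ℝ F]
    (f : ℂ → F) : ∫ z, f z ∂(standardComplexNormal : Measure ℂ) =
      ∫ z : ℂ, (Real.exp (-‖z‖ ^ 2) / Real.pi) • f z := by
  have h : (standardComplexNormal : Measure ℂ) =
    volume.withDensity fun z : ℂ => ENNReal.ofReal (Real.exp (-‖z‖ ^ 2) / Real.pi) := rfl
  rw [h, integral_withDensity_eq_integral_toReal_smul (by fun_prop)
    (Eventually.of_forall fun _ => ENNReal.ofReal_lt_top)]
  congr 1
  ext z
  rw [ENNReal.toReal_ofReal (by have := Real.pi_pos; positivity)]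

theorem charFun_standardComplexNormal (θ : ℂ) :
    charFun (standardComplexNormal : Measure ℂ) θ =
      (Real.exp (-(1 / 2 * ‖θ‖ ^ 2 / 2)) : ℝ) := by
  rw [charFun_apply, integral_standardComplexNormal, ← integral_cexp_inner_mul_gaussian]
  congr 1
  ext z
  rw [Complex.real_smul, mul_comm]

theorem integral_cos_norm_standardComplexNormal (t : ℝ) :
    ∫ z, Real.cos (t * ‖z‖) ∂(standardComplexNormal : Measure ℂ) =
      ∫ x : ℝ, Real.cos (t * x) * (|x| * Real.exp (-x ^ 2)) := by
  have h1 := integral_fun_norm_addHaar (volume : Measure ℂ)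
    (fun r => (Real.exp (-r ^ 2) / Real.pi) • Real.cos (t * r))
  have h2 := integral_comp_abs (f := fun x : ℝ => Real.cos (t * x) * (x * Real.exp (-x ^ 2)))
  have h3 : ∀ x : ℝ, Real.cos (t * |x|) = Real.cos (t * x) := fun x => by
    rcases abs_cases x with h | h <;> simp [h.1]
  simp only [sq_abs, h3] at h2
  rw [integral_standardComplexNormal, h1, h2, Complex.finrank_real_complex, measureReal_def,
    Complex.volume_ball]
  simp only [smul_eq_mul, nsmul_eq_mul]
  rw [← integral_const_mul, ← integral_const_mul, ← integral_const_mul]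
  congr 1
  ext x
  have := Real.pi_ne_zero
  simp
  field_simp

theorem charFun_symmetrizedRayleigh (t : ℝ) :
    charFun (symmetrizedRayleigh : Measure ℝ) t =
      ((∫ z, Real.cos (t * ‖z‖) ∂(standardComplexNormal : Measure ℂ) : ℝ) : ℂ) := by
  have h : (symmetrizedRayleigh : Measure ℝ) =
    volume.withDensity fun x : ℝ => ENNReal.ofReal (|x| * Real.exp (-x ^ 2)) := rfl
  have hi : Integrable fun x : ℝ => |x| * Real.exp (-x ^ 2) := by
    refine ⟨by fun_prop, ?_⟩
    rw [hasFiniteIntegral_iff_ofReal (Eventually.of_forall fun x => by positivity),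
      lintegral_symmetrizedRayleigh]
    exact ENNReal.one_lt_top
  have hc : Integrable fun x : ℝ => Real.cos (t * x) * (|x| * Real.exp (-x ^ 2)) :=
    hi.bdd_mul (c := 1) (by fun_prop) (Eventually.of_forall fun x => Real.abs_cos_le_one _)
  have hs : Integrable fun x : ℝ => Real.sin (t * x) * (|x| * Real.exp (-x ^ 2)) :=
    hi.bdd_mul (c := 1) (by fun_prop) (Eventually.of_forall fun x => Real.abs_sin_le_one _)
  have hodd : ∫ x : ℝ, Real.sin (t * x) * (|x| * Real.exp (-x ^ 2)) = 0 := by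
    have := integral_neg_eq_self (fun x : ℝ => Real.sin (t * x) * (|x| * Real.exp (-x ^ 2)))
      volume
    simp only [mul_neg, Real.sin_neg, abs_neg, neg_sq, neg_mul] at this
    rw [integral_neg] at this
    linarith
  rw [charFun_apply_real, h, integral_withDensity_eq_integral_toReal_smul (by fun_prop)
    (Eventually.of_forall fun _ => ENNReal.ofReal_lt_top),
    integral_cos_norm_standardComplexNormal]
  calc _ = ∫ x : ℝ, (((Real.cos (t * x) * (|x| * Real.exp (-x ^ 2)) : ℝ) : ℂ) +
        ((Real.sin (t * x) * (|x| * Real.exp (-x ^ 2)) : ℝ) : ℂ) * Complex.I) := by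
        congr 1
        ext x
        rw [ENNReal.toReal_ofReal (by positivity), Complex.real_smul, ← Complex.ofReal_mul t,
          Complex.exp_mul_I]
        push_cast
        ring
    _ = _ := by
        rw [integral_add hc.ofReal (hs.ofReal.mul_const _), integral_mul_const,
          integral_complex_ofReal, integral_complex_ofReal, hodd]
        simp

end ComplexGaussian

section Spectra

open ZMod (stdAddChar)

variable {n : ℕ}

theorem charFun_spectralDistribution {N : ℕ} [NeZero N] (A : Matrix (Fin N) (Fin N) ℝ)
    (hA : A.IsHermitian) (t : ℝ) :
    charFun (spectralDistribution A hA : Measure ℝ) t =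
      (N : ℂ)⁻¹ * (((∑ i, Real.cos (t * hA.eigenvalues i) : ℝ) : ℂ) +
        ((∑ i, Real.sin (t * hA.eigenvalues i) : ℝ) : ℂ) * Complex.I) := by
  rw [spectralDistribution_eq_empiricalMeasure, charFun_empiricalMeasure]
  congr 1
  push_cast
  rw [Finset.sum_mul, ← Finset.sum_add_distrib]
  refine Finset.sum_congr rfl fun i _ => ?_
  rw [Complex.exp_mul_I]
  simp

/-- The row of the scaled reverse circulant matrix. -/
def scaledRow (n : ℕ) (x : ℕ → ℝ) (d : ZMod (n + 1)) : ℝ :=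
  (√((n + 1 : ℕ) : ℝ))⁻¹ * x d.val

theorem smul_reverseCirculant_eq (n : ℕ) (x : ℕ → ℝ) :
    (√((n + 1 : ℕ) : ℝ))⁻¹ • reverseCirculant (n + 1) x =
      Matrix.of fun i j : ZMod (n + 1) => scaledRow n x (i + j) := by
  ext i j
  rfl

theorem norm_charFun_spectralDistribution_reverseCirculant_sub_le (n : ℕ) (x : ℕ → ℝ) (t : ℝ) :
    ‖charFun (spectralDistribution ((√((n + 1 : ℕ) : ℝ))⁻¹ • reverseCirculant (n + 1) x)
        (reverseCirculant_isHermitian (n + 1) x) : Measure ℝ) t -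
      (((((n + 1 : ℕ) : ℝ)⁻¹ * ∑ k, Real.cos (t * ‖fourierSum (scaledRow n x) k‖) : ℝ)) : ℂ)‖ ≤
      2 / ((n + 1 : ℕ) : ℝ) := by
  set hA := reverseCirculant_isHermitian (n + 1) x
  have htr := hA.trace_pow_eq_sum_eigenvalues_pow
  have hcos := sum_cos_eq_of_sum_pow_eq (S := Finset.univ) (T := Finset.univ)
    (x := hA.eigenvalues) (y := fun k => ‖fourierSum (scaledRow n x) k‖) (fun m => by
      rw [← htr, ← trace_reverseCirculant_pow_two_mul, smul_reverseCirculant_eq]; rfl) t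
  have hsin := sum_sin_eq_of_sum_pow_eq (S := Finset.univ)
    (T := Finset.univ.filter fun k : ZMod (n + 1) => k = -k)
    (x := hA.eigenvalues) (y := fun k => (fourierSum (scaledRow n x) k).re) (fun m => by
      rw [← htr, ← trace_reverseCirculant_pow_two_mul_add_one, smul_reverseCirculant_eq]; rfl) t
  rw [charFun_spectralDistribution, hcos, hsin]
  have hle : |∑ k with k = -k, Real.sin (t * (fourierSum (scaledRow n x) k).re)| ≤ 2 := by
    refine (Finset.abs_sum_le_sum_abs _ _).trans ((Finset.sum_le_sum fun k _ =>
      Real.abs_sin_le_one _).trans ?_)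
    simp only [Finset.sum_const, nsmul_eq_mul, mul_one]
    exact_mod_cast card_filter_eq_neg_le
  have e : ∀ c s : ℝ, (((n + 1 : ℕ) : ℂ))⁻¹ * ((c : ℂ) + (s : ℂ) * Complex.I) -
      (((((n + 1 : ℕ) : ℝ)⁻¹ * c : ℝ)) : ℂ) = (((n + 1 : ℕ) : ℂ))⁻¹ * ((s : ℂ) * Complex.I) :=
    fun c s => by push_cast; ring
  rw [e, norm_mul, norm_mul, Complex.norm_I, mul_one, norm_inv, Complex.norm_natCast,
    Complex.norm_real, Real.norm_eq_abs, div_eq_inv_mul]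
  exact mul_le_mul_of_nonneg_left hle (by positivity)

/-- Distance to `0` on the cycle `ZMod (n + 1)`. -/
def foldIndex (n : ℕ) (d : ZMod (n + 1)) : ZMod (n + 1) := ((min d.val (n + 1 - d.val) : ℕ) : ZMod _)

theorem val_foldIndex (d : ZMod (n + 1)) : (foldIndex n d).val = min d.val (n + 1 - d.val) :=
  ZMod.val_cast_of_lt ((min_le_left _ _).trans_lt (ZMod.val_lt d))

theorem foldIndex_eq_or (d : ZMod (n + 1)) : foldIndex n d = d ∨ foldIndex n d = -d := by
  unfold foldIndex
  rcases min_choice d.val (n + 1 - d.val) with h | h <;> rw [h]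
  · left; simp
  · right; rw [Nat.cast_sub (ZMod.val_lt d).le]; simp

theorem foldIndex_neg (d : ZMod (n + 1)) : foldIndex n (-d) = foldIndex n d := by
  unfold foldIndex
  rw [ZMod.neg_val]
  split_ifs with h
  · simp [h]
  · rw [Nat.sub_sub_self (ZMod.val_lt d).le, min_comm]

theorem smul_symmetricCirculant_eq (n : ℕ) (x : ℕ → ℝ) :
    (√((n + 1 : ℕ) : ℝ))⁻¹ • symmetricCirculant (n + 1) x =
      Matrix.of fun i j : ZMod (n + 1) => scaledRow n x (foldIndex n (i - j)) := by
  ext i j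
  simp only [Matrix.smul_apply, symmetricCirculant, Matrix.circulant_apply, smul_eq_mul,
    scaledRow, val_foldIndex]
  rfl

theorem charFun_spectralDistribution_symmetricCirculant (n : ℕ) (x : ℕ → ℝ) (t : ℝ) :
    charFun (spectralDistribution ((√((n + 1 : ℕ) : ℝ))⁻¹ • symmetricCirculant (n + 1) x)
        (symmetricCirculant_isHermitian (n + 1) x) : Measure ℝ) t =
      ((n + 1 : ℕ) : ℂ)⁻¹ * ∑ k, Complex.exp
        ((t * (fourierSum (fun d => scaledRow n x (foldIndex n d)) k).re : ℝ) * Complex.I) := by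
  set hA := symmetricCirculant_isHermitian (n + 1) x
  have htr := hA.trace_pow_eq_sum_eigenvalues_pow
  have hp : ∀ m, ∑ i, hA.eigenvalues i ^ m =
      ∑ k, (fourierSum (fun d => scaledRow n x (foldIndex n d)) k).re ^ m := fun m => by
    rw [← htr, ← trace_circulant_pow _ (fun d => by rw [foldIndex_neg]),
      smul_symmetricCirculant_eq]
    rfl
  rw [charFun_spectralDistribution, sum_cos_eq_of_sum_pow_eq (fun m => hp _),
    sum_sin_eq_of_sum_pow_eq (fun m => hp _)]
  congr 1
  push_cast
  rw [Finset.sum_mul, ← Finset.sum_add_distrib]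
  refine Finset.sum_congr rfl fun i _ => ?_
  rw [Complex.exp_mul_I]

end Spectra

section Arrays

open ZMod (stdAddChar)
open scoped RealInnerProductSpace

variable {n : ℕ}

theorem stdAddChar_re_sq_add_im_sq (a : ZMod (n + 1)) :
    (stdAddChar a).re ^ 2 + (stdAddChar a).im ^ 2 = 1 := by
  have h : Complex.normSq (stdAddChar a) = 1 := by
    rw [Complex.normSq_eq_norm_sq, norm_stdAddChar, one_pow]
  rw [Complex.normSq_apply] at h
  linear_combination h

/-- `Fin (n + 1)` and `ZMod (n + 1)` are the same index set. -/
def finEquivZMod (n : ℕ) : Fin (n + 1) ≃ ZMod (n + 1) := Equiv.refl _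

theorem val_finEquivZMod (j : Fin (n + 1)) : (finEquivZMod n j).val = j := rfl

theorem sum_norm_fourierSum_scaled_sq (n : ℕ) (z : ZMod (n + 1) → ℝ) :
    ∑ k, ‖fourierSum (fun d => (√((n + 1 : ℕ) : ℝ))⁻¹ * z d) k‖ ^ 2 = ∑ d, z d ^ 2 := by
  rw [sum_norm_fourierSum_sq]
  simp_rw [mul_pow]
  rw [← Finset.mul_sum, inv_pow, Real.sq_sqrt (by positivity), ← mul_assoc,
    mul_inv_cancel₀ (by positivity), one_mul]

theorem sum_ite_add_self_eq_zero_le (n : ℕ) (C : ℝ) (hC : 0 ≤ C) :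
    ∑ k : ZMod (n + 1), (if k + k = 0 then C else 0) ≤ 2 * C := by
  rw [← Finset.sum_filter, Finset.sum_const, nsmul_eq_mul]
  refine mul_le_mul_of_nonneg_right ?_ hC
  have := card_filter_eq_neg_le (N := n + 1)
  simp only [eq_neg_iff_add_eq_zero] at this
  exact_mod_cast this

theorem tendsto_const_div_natCast_succ (C : ℝ) :
    Tendsto (fun n : ℕ => C / ((n + 1 : ℕ) : ℝ)) atTop (𝓝 0) :=
  tendsto_const_nhds.div_atTop (tendsto_natCast_atTop_atTop.comp (tendsto_add_atTop_nat 1))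

/-- The normalized Fourier array, whose linear forms are the scaled discrete Fourier transforms. -/
def fourierArray (n : ℕ) (k j : ZMod (n + 1)) : ℂ :=
  ((√((n + 1 : ℕ) : ℝ))⁻¹ : ℝ) • stdAddChar (j * k)

theorem norm_fourierArray (k j : ZMod (n + 1)) :
    ‖fourierArray n k j‖ = 1 / √((n + 1 : ℕ) : ℝ) := by
  rw [fourierArray, norm_smul, norm_stdAddChar, Real.norm_eq_abs, abs_of_nonneg (by positivity),
    mul_one, one_div]

theorem sum_smul_fourierArray (z : ZMod (n + 1) → ℝ) (k : ZMod (n + 1)) :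
    ∑ j, z j • fourierArray n k j =
      fourierSum (fun d => (√((n + 1 : ℕ) : ℝ))⁻¹ * z d) k := by
  refine Finset.sum_congr rfl fun j _ => ?_
  rw [fourierArray, smul_smul, mul_comm, Complex.real_smul]

theorem abs_sum_inner_fourierArray_sq_sub_le (k : ZMod (n + 1)) (θ : ℂ) :
    |∑ j, ⟪fourierArray n k j, θ⟫ ^ 2 - 1 / 2 * ‖θ‖ ^ 2| ≤
      if k + k = 0 then 1 / 2 * ‖θ‖ ^ 2 else 0 := by
  have hN : (0 : ℝ) < ((n + 1 : ℕ) : ℝ) := by positivity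
  have h1 : ∀ j, ⟪fourierArray n k j, θ⟫ ^ 2 = ((n + 1 : ℕ) : ℝ)⁻¹ * (1 / 2 * ‖θ‖ ^ 2) +
      ((n + 1 : ℕ) : ℝ)⁻¹ * (1 / 2 * (stdAddChar (j * (k + k)) *
        ((starRingEnd ℂ) θ) ^ 2).re) := fun j => by
    have h3 : stdAddChar (j * (k + k)) = stdAddChar (j * k) ^ 2 := by
      rw [mul_add, AddChar.map_add_eq_mul, sq]
    rw [fourierArray, real_inner_smul_left, mul_pow, inv_pow, Real.sq_sqrt hN.le, h3,
      ← mul_add]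
    congr 1
    rw [Complex.inner, ← Complex.normSq_eq_norm_sq, Complex.normSq_apply]
    have h4 := stdAddChar_re_sq_add_im_sq (j * k)
    set e := stdAddChar (j * k)
    simp only [Complex.mul_re, Complex.conj_re, Complex.conj_im, sq, Complex.mul_im]
    linear_combination (1 / 2 * (θ.re * θ.re + θ.im * θ.im)) * h4
  have hc : ∑ _j : ZMod (n + 1), ((n + 1 : ℕ) : ℝ)⁻¹ * (1 / 2 * ‖θ‖ ^ 2) = 1 / 2 * ‖θ‖ ^ 2 := by
    rw [Finset.sum_const, Finset.card_univ, ZMod.card, nsmul_eq_mul, ← mul_assoc,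
      mul_inv_cancel₀ hN.ne', one_mul]
  rw [Finset.sum_congr rfl fun j _ => h1 j, Finset.sum_add_distrib, hc, add_sub_cancel_left,
    ← Finset.mul_sum, ← Finset.mul_sum, ← Complex.re_sum, ← Finset.sum_mul, sum_stdAddChar_mul]
  split_ifs with h
  · have h5 : ((((n + 1 : ℕ) : ℂ)) * ((starRingEnd ℂ) θ) ^ 2).re =
        ((n + 1 : ℕ) : ℝ) * (((starRingEnd ℂ) θ) ^ 2).re := by
      rw [← Complex.ofReal_natCast, Complex.re_ofReal_mul]
    rw [h5, mul_left_comm (1 / 2 : ℝ), inv_mul_cancel_left₀ hN.ne', abs_mul,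
      abs_of_pos (by norm_num : (0 : ℝ) < 1 / 2)]
    refine mul_le_mul_of_nonneg_left ((Complex.abs_re_le_norm _).trans ?_) (by norm_num)
    rw [norm_pow, Complex.norm_conj]
  · simp

/-- The array of coefficients of the eigenvalues of the scaled symmetric circulant matrix. -/
def cosineArray (n : ℕ) (k j : ZMod (n + 1)) : ℝ :=
  (√((n + 1 : ℕ) : ℝ))⁻¹ * ∑ d, if foldIndex n d = j then (stdAddChar (d * k)).re else 0

theorem stdAddChar_foldIndex_re (d k : ZMod (n + 1)) :
    (stdAddChar (foldIndex n d * k)).re = (stdAddChar (d * k)).re := by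
  rcases foldIndex_eq_or d with h | h <;> rw [h]
  rw [neg_mul, stdAddChar_neg, Complex.conj_re]

theorem card_foldIndex_eq_le (j : ZMod (n + 1)) :
    (Finset.univ.filter fun d => foldIndex n d = j).card ≤ 2 := by
  have h : (Finset.univ.filter fun d => foldIndex n d = j) ⊆ {j, -j} := by
    intro d hd
    have hd' : foldIndex n d = j := by simpa using hd
    rw [Finset.mem_insert, Finset.mem_singleton, ← hd']
    rcases foldIndex_eq_or d with h | h <;> rw [h] <;> simp
  exact (Finset.card_le_card h).trans Finset.card_le_two

theorem cosineArray_eq (k j : ZMod (n + 1)) :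
    cosineArray n k j = (√((n + 1 : ℕ) : ℝ))⁻¹ *
      ((Finset.univ.filter fun d => foldIndex n d = j).card * (stdAddChar (j * k)).re) := by
  rw [cosineArray, ← Finset.sum_filter, ← nsmul_eq_mul, ← Finset.sum_const]
  congr 1
  refine Finset.sum_congr rfl fun d hd => ?_
  rw [← (Finset.mem_filter.1 hd).2, stdAddChar_foldIndex_re]

theorem abs_cosineArray_le (k j : ZMod (n + 1)) :
    |cosineArray n k j| ≤ 2 / √((n + 1 : ℕ) : ℝ) := by
  have h1 : ((Finset.univ.filter fun d => foldIndex n d = j).card : ℝ) ≤ 2 := by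
    exact_mod_cast card_foldIndex_eq_le j
  have h2 : |(stdAddChar (j * k)).re| ≤ 1 :=
    (Complex.abs_re_le_norm _).trans (norm_stdAddChar _).le
  rw [cosineArray_eq, abs_mul, abs_mul, abs_of_nonneg (by positivity : 0 ≤ (√((n + 1 : ℕ) : ℝ))⁻¹),
    Nat.abs_cast, div_eq_inv_mul]
  refine mul_le_mul_of_nonneg_left ?_ (by positivity)
  nlinarith [abs_nonneg (stdAddChar (j * k)).re]

theorem sum_mul_cosineArray (z : ZMod (n + 1) → ℝ) (k : ZMod (n + 1)) :
    ∑ j, z j * cosineArray n k j =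
      (fourierSum (fun d => (√((n + 1 : ℕ) : ℝ))⁻¹ * z (foldIndex n d)) k).re := by
  rw [fourierSum_re]
  simp only [cosineArray, Finset.mul_sum]
  rw [Finset.sum_comm]
  refine Finset.sum_congr rfl fun d _ => ?_
  simp only [mul_ite, mul_zero, Finset.sum_ite_eq, Finset.mem_univ, if_true]
  ring

theorem sum_comp_foldIndex (g : ZMod (n + 1) → ℝ) :
    ∑ d, g (foldIndex n d) =
      ∑ j, ((Finset.univ.filter fun d => foldIndex n d = j).card : ℝ) * g j := by
  rw [← Finset.sum_fiberwise Finset.univ (foldIndex n)]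
  refine Finset.sum_congr rfl fun j _ => ?_
  rw [Finset.sum_congr rfl fun d hd => by rw [(Finset.mem_filter.1 hd).2], Finset.sum_const,
    nsmul_eq_mul]

theorem sum_sq_sum_mul_cosineArray_le (z : ZMod (n + 1) → ℝ) :
    ∑ k, (∑ j, z j * cosineArray n k j) ^ 2 ≤ 2 * ∑ j, z j ^ 2 := by
  calc _ ≤ ∑ k, ‖fourierSum (fun d => (√((n + 1 : ℕ) : ℝ))⁻¹ * z (foldIndex n d)) k‖ ^ 2 := by
        refine Finset.sum_le_sum fun k _ => ?_
        rw [sum_mul_cosineArray, ← sq_abs]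
        exact pow_le_pow_left₀ (abs_nonneg _) (Complex.abs_re_le_norm _) 2
    _ = ∑ d, z (foldIndex n d) ^ 2 :=
        sum_norm_fourierSum_scaled_sq n fun d => z (foldIndex n d)
    _ ≤ _ := by
        rw [sum_comp_foldIndex fun j => z j ^ 2, Finset.mul_sum]
        refine Finset.sum_le_sum fun j _ => mul_le_mul_of_nonneg_right ?_ (sq_nonneg _)
        exact_mod_cast card_foldIndex_eq_le j

theorem two_sub_card_foldIndex_fiber_le (d : ZMod (n + 1)) :
    2 - ((Finset.univ.filter fun d' => foldIndex n d' = foldIndex n d).card : ℝ) ≤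
      if d + d = 0 then 1 else 0 := by
  have hd : d ∈ Finset.univ.filter fun d' => foldIndex n d' = foldIndex n d := by simp
  have hd' : -d ∈ Finset.univ.filter fun d' => foldIndex n d' = foldIndex n d := by
    simp [foldIndex_neg]
  split_ifs with h
  · have : 1 ≤ (Finset.univ.filter fun d' => foldIndex n d' = foldIndex n d).card :=
      Finset.card_pos.2 ⟨d, hd⟩
    have : (1 : ℝ) ≤ (Finset.univ.filter fun d' => foldIndex n d' = foldIndex n d).card := by
      exact_mod_cast this
    linarith
  · have hne : d ≠ -d := fun hc => h (eq_neg_iff_add_eq_zero.1 hc)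
    have : 2 ≤ (Finset.univ.filter fun d' => foldIndex n d' = foldIndex n d).card := by
      rw [← Finset.card_pair hne]
      exact Finset.card_le_card (by simp [Finset.insert_subset_iff, foldIndex_neg])
    have : (2 : ℝ) ≤ (Finset.univ.filter fun d' => foldIndex n d' = foldIndex n d).card := by
      exact_mod_cast this
    linarith

theorem abs_sum_cosineArray_sq_sub_one_le (k : ZMod (n + 1)) :
    |∑ j, cosineArray n k j ^ 2 - 1| ≤
      (if k + k = 0 then 1 else 0) + 2 / ((n + 1 : ℕ) : ℝ) := by
  have hN : (0 : ℝ) < ((n + 1 : ℕ) : ℝ) := by positivity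
  set w : ZMod (n + 1) → ℝ := fun d =>
    ((Finset.univ.filter fun d' => foldIndex n d' = foldIndex n d).card : ℝ) with hw
  have hw2 : ∀ d, w d ≤ 2 := fun d => by
    simp only [hw]
    exact_mod_cast card_foldIndex_eq_le (foldIndex n d)
  have h1 : ∑ j, cosineArray n k j ^ 2 =
      ((n + 1 : ℕ) : ℝ)⁻¹ * ∑ d, w d * (stdAddChar (d * k)).re ^ 2 := by
    have h := sum_comp_foldIndex (n := n) fun j =>
      ((Finset.univ.filter fun d' => foldIndex n d' = j).card : ℝ) * (stdAddChar (j * k)).re ^ 2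
    simp only [stdAddChar_foldIndex_re] at h
    rw [h, Finset.mul_sum]
    refine Finset.sum_congr rfl fun j _ => ?_
    rw [cosineArray_eq, mul_pow, inv_pow, Real.sq_sqrt hN.le]
    ring
  have h2 : ∑ d, 2 * (stdAddChar (d * k)).re ^ 2 =
      ((n + 1 : ℕ) : ℝ) + if k + k = 0 then ((n + 1 : ℕ) : ℝ) else 0 := by
    have h3 : ∀ d, 2 * (stdAddChar (d * k)).re ^ 2 = 1 + (stdAddChar (d * (k + k))).re := by
      intro d
      have h4 := stdAddChar_re_sq_add_im_sq (d * k)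
      rw [mul_add, AddChar.map_add_eq_mul, Complex.mul_re]
      linear_combination h4
    simp_rw [h3]
    rw [Finset.sum_add_distrib, ← Complex.re_sum, sum_stdAddChar_mul]
    split_ifs <;> simp [ZMod.card]
  have h5 : ∑ d, (2 - w d) * (stdAddChar (d * k)).re ^ 2 ≤ 2 := by
    refine (Finset.sum_le_sum fun d _ => ?_).trans
      ((sum_ite_add_self_eq_zero_le n 1 zero_le_one).trans_eq (mul_one 2))
    have h6 : (stdAddChar (d * k)).re ^ 2 ≤ 1 := by
      rw [← sq_abs]
      exact pow_le_one₀ (abs_nonneg _) ((Complex.abs_re_le_norm _).trans (norm_stdAddChar _).le)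
    have h7 := two_sub_card_foldIndex_fiber_le d
    have h8 : 0 ≤ 2 - w d := sub_nonneg.2 (hw2 d)
    exact (mul_le_of_le_one_right h8 h6).trans h7
  have h9 : 0 ≤ ∑ d, (2 - w d) * (stdAddChar (d * k)).re ^ 2 :=
    Finset.sum_nonneg fun d _ => mul_nonneg (sub_nonneg.2 (hw2 d)) (sq_nonneg _)
  have h10 : ∑ d, w d * (stdAddChar (d * k)).re ^ 2 = ∑ d, 2 * (stdAddChar (d * k)).re ^ 2 -
      ∑ d, (2 - w d) * (stdAddChar (d * k)).re ^ 2 := by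
    rw [← Finset.sum_sub_distrib]
    exact Finset.sum_congr rfl fun d _ => by ring
  set T := ∑ d, (2 - w d) * (stdAddChar (d * k)).re ^ 2
  have h11 : ∑ j, cosineArray n k j ^ 2 - 1 =
      (if k + k = 0 then 1 else 0) - T / ((n + 1 : ℕ) : ℝ) := by
    rw [h1, h10, h2]
    split_ifs <;> field_simp <;> ring
  rw [h11]
  have h12 : T / ((n + 1 : ℕ) : ℝ) ≤ 2 / ((n + 1 : ℕ) : ℝ) := by gcongr
  have h13 : 0 ≤ T / ((n + 1 : ℕ) : ℝ) := by positivity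
  refine (abs_sub _ _).trans (add_le_add ?_ ?_)
  · split_ifs <;> simp
  · rwa [abs_of_nonneg h13]

end Arrays

section Main

open scoped RealInnerProductSpace

variable {Ω : Type*} [MeasurableSpace Ω] {P : Measure Ω} [IsProbabilityMeasure P]

theorem ae_tendsto_spectralDistribution_symmetricCirculant {X : ℕ → Ω → ℝ}
    (hX : ∀ j, Measurable (X j)) (hindep : iIndepFun X P) (hmean : ∀ j, ∫ ω, X j ω ∂P = 0)
    (hvar : ∀ j, ∫ ω, X j ω ^ 2 ∂P = 1)
    (hint : ∀ j, Integrable (fun ω => |X j ω| ^ 3) P) {M : ℝ} (hM0 : 0 < M)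
    (hM : ∀ j, ∫ ω, |X j ω| ^ 3 ∂P ≤ M) :
    ∀ᵐ ω ∂P, Tendsto
      (fun n : ℕ => spectralDistribution
        ((√((n + 1 : ℕ) : ℝ))⁻¹ • symmetricCirculant (n + 1) (fun j => X j ω))
        (symmetricCirculant_isHermitian (n + 1) (fun j => X j ω)))
      atTop (𝓝 standardNormal) := by
  have h := ae_forall_tendsto_empiricalCharFun hX hindep hmean hvar hint hM0 hM
    (v := fun n k j => cosineArray n (finEquivZMod n k) (finEquivZMod n j)) (c := 2) (D := 2)
    (s := 1) (fun n k j => abs_cosineArray_le _ _) zero_le_two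
    (fun n z => by
      have h := sum_sq_sum_mul_cosineArray_le (n := n) (z ∘ (finEquivZMod n).symm)
      simp_rw [← (finEquivZMod n).sum_comp] at h
      simpa only [smul_eq_mul, Real.norm_eq_abs, sq_abs, Function.comp_apply,
        Equiv.symm_apply_apply] using h)
    zero_le_one (fun θ => by
      refine squeeze_zero (fun n => by positivity) (fun n => ?_)
        (tendsto_const_div_natCast_succ (4 * θ ^ 2))
      have hN : (0 : ℝ) < ((n + 1 : ℕ) : ℝ) := by positivity
      rw [inv_mul_le_iff₀ hN, mul_div_cancel₀ _ hN.ne']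
      have hk : ∀ k : ZMod (n + 1),
          |∑ j, ⟪cosineArray n k (finEquivZMod n j), θ⟫ ^ 2 - 1 * ‖θ‖ ^ 2| ≤
          θ ^ 2 * ((if k + k = 0 then 1 else 0) + 2 / ((n + 1 : ℕ) : ℝ)) := fun k => by
        have e : ∑ j, ⟪cosineArray n k (finEquivZMod n j), θ⟫ ^ 2 - 1 * ‖θ‖ ^ 2 =
            θ ^ 2 * (∑ j, cosineArray n k j ^ 2 - 1) := by
          rw [Real.norm_eq_abs, sq_abs, mul_sub, Finset.mul_sum,
            ← (finEquivZMod n).sum_comp fun j => θ ^ 2 * cosineArray n k j ^ 2]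
          congr 1
          · refine Finset.sum_congr rfl fun j _ => ?_
            simp [mul_pow]
          · ring
        rw [e, abs_mul, abs_of_nonneg (sq_nonneg θ)]
        exact mul_le_mul_of_nonneg_left (abs_sum_cosineArray_sq_sub_one_le k) (sq_nonneg θ)
      refine (Finset.sum_le_sum fun k _ => hk (finEquivZMod n k)).trans ?_
      rw [(finEquivZMod n).sum_comp fun k =>
        θ ^ 2 * ((if k + k = 0 then 1 else 0) + 2 / ((n + 1 : ℕ) : ℝ)), ← Finset.mul_sum,
        mul_comm (4 : ℝ)]
      refine mul_le_mul_of_nonneg_left ?_ (sq_nonneg θ)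
      have h1 := sum_ite_add_self_eq_zero_le n 1 zero_le_one
      rw [Finset.sum_add_distrib, Finset.sum_const, Finset.card_univ, ZMod.card, nsmul_eq_mul,
        mul_div_cancel₀ _ hN.ne']
      linarith)
  filter_upwards [h] with ω hω
  rw [ProbabilityMeasure.tendsto_iff_tendsto_charFun]
  intro t
  have hlim : charFun (standardNormal : Measure ℝ) t =
      ((Real.exp (-(1 * ‖t‖ ^ 2 / 2)) : ℝ) : ℂ) := by
    have e : (standardNormal : Measure ℝ) = gaussianReal 0 1 := rfl
    rw [e, charFun_gaussianReal]
    simp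
  rw [hlim]
  refine (hω t).congr fun n => ?_
  rw [charFun_spectralDistribution_symmetricCirculant, empiricalCharFun,
    ← (finEquivZMod n).sum_comp]
  congr 1
  refine Finset.sum_congr rfl fun k _ => ?_
  congr 3
  have h1 := sum_mul_cosineArray (n := n) (fun j => X j.val ω) (finEquivZMod n k)
  simp only [scaledRow]
  rw [← h1, Finset.mul_sum, ← (finEquivZMod n).sum_comp]
  refine Finset.sum_congr rfl fun j _ => ?_
  simp only [val_finEquivZMod, RCLike.inner_apply, conj_trivial]
  ring

theorem ae_tendsto_spectralDistribution_reverseCirculant {X : ℕ → Ω → ℝ}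
    (hX : ∀ j, Measurable (X j)) (hindep : iIndepFun X P) (hmean : ∀ j, ∫ ω, X j ω ∂P = 0)
    (hvar : ∀ j, ∫ ω, X j ω ^ 2 ∂P = 1)
    (hint : ∀ j, Integrable (fun ω => |X j ω| ^ 3) P) {M : ℝ} (hM0 : 0 < M)
    (hM : ∀ j, ∫ ω, |X j ω| ^ 3 ∂P ≤ M) :
    ∀ᵐ ω ∂P, Tendsto
      (fun n : ℕ => spectralDistribution
        ((√((n + 1 : ℕ) : ℝ))⁻¹ • reverseCirculant (n + 1) (fun j => X j ω))
        (reverseCirculant_isHermitian (n + 1) (fun j => X j ω)))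
      atTop (𝓝 symmetrizedRayleigh) := by
  have h := ae_forall_tendsto_empiricalCharFun hX hindep hmean hvar hint hM0 hM
    (v := fun n k j => fourierArray n (finEquivZMod n k) (finEquivZMod n j)) (c := 1) (D := 1)
    (s := 1 / 2) (fun n k j => (norm_fourierArray _ _).le) zero_le_one
    (fun n z => by
      have h := sum_norm_fourierSum_scaled_sq n (z ∘ (finEquivZMod n).symm)
      simp only [← sum_smul_fourierArray] at h
      simp_rw [← (finEquivZMod n).sum_comp, Function.comp_apply, Equiv.symm_apply_apply] at h
      rw [one_mul]
      exact h.le)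
    (by norm_num) (fun θ => by
      refine squeeze_zero (fun n => by positivity) (fun n => ?_)
        (tendsto_const_div_natCast_succ (2 * (1 / 2 * ‖θ‖ ^ 2)))
      have hN : (0 : ℝ) < ((n + 1 : ℕ) : ℝ) := by positivity
      rw [inv_mul_le_iff₀ hN, mul_div_cancel₀ _ hN.ne']
      have h := Finset.sum_le_sum fun (k : ZMod (n + 1)) (_ : k ∈ Finset.univ) =>
        abs_sum_inner_fourierArray_sq_sub_le k θ
      simp_rw [← (finEquivZMod n).sum_comp] at h
      refine h.trans ?_
      rw [(finEquivZMod n).sum_comp fun k => if k + k = 0 then 1 / 2 * ‖θ‖ ^ 2 else 0]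
      exact sum_ite_add_self_eq_zero_le n _ (by positivity))
  filter_upwards [h] with ω hω
  have hν : Tendsto (fun n : ℕ => empiricalMeasure fun k =>
      fourierSum (scaledRow n fun j => X j ω) (finEquivZMod n k)) atTop
      (𝓝 standardComplexNormal) := by
    rw [ProbabilityMeasure.tendsto_iff_tendsto_charFun]
    intro θ
    rw [charFun_standardComplexNormal]
    refine (hω θ).congr fun n => ?_
    rw [charFun_empiricalMeasure, empiricalCharFun]
    congr 1
    refine Finset.sum_congr rfl fun k _ => ?_
    congr 3
    have h1 := sum_smul_fourierArray (n := n) (fun j => X j.val ω) (finEquivZMod n k)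
    change _ = ⟪fourierSum (fun d => (√((n + 1 : ℕ) : ℝ))⁻¹ * X d.val ω) (finEquivZMod n k), θ⟫
    rw [← h1, sum_inner, ← (finEquivZMod n).sum_comp]
    refine Finset.sum_congr rfl fun j _ => ?_
    rw [real_inner_smul_left, val_finEquivZMod]
  rw [ProbabilityMeasure.tendsto_iff_tendsto_charFun]
  intro t
  rw [charFun_symmetrizedRayleigh]
  have hcos := ProbabilityMeasure.tendsto_iff_forall_integral_tendsto.1 hν
    (BoundedContinuousFunction.ofNormedAddCommGroup (fun z : ℂ => Real.cos (t * ‖z‖))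
      (by fun_prop) 1 fun z => Real.abs_cos_le_one _)
  simp only [BoundedContinuousFunction.coe_ofNormedAddCommGroup] at hcos
  have hcos' := (Complex.continuous_ofReal.tendsto _).comp hcos
  rw [← tendsto_sub_nhds_zero_iff] at hcos' ⊢
  have hdiff : Tendsto (fun n : ℕ =>
      charFun (spectralDistribution
        ((√((n + 1 : ℕ) : ℝ))⁻¹ • reverseCirculant (n + 1) (fun j => X j ω))
        (reverseCirculant_isHermitian (n + 1) (fun j => X j ω)) : Measure ℝ) t -
      ((∫ z, Real.cos (t * ‖z‖) ∂(empiricalMeasure fun k =>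
        fourierSum (scaledRow n fun j => X j ω) (finEquivZMod n k) : Measure ℂ) : ℝ) : ℂ)) atTop (𝓝 0) := by
    rw [tendsto_zero_iff_norm_tendsto_zero]
    refine squeeze_zero (fun _ => norm_nonneg _) (fun n => ?_) (tendsto_const_div_natCast_succ 2)
    rw [integral_empiricalMeasure, smul_eq_mul, (finEquivZMod n).sum_comp fun k =>
      Real.cos (t * ‖fourierSum (scaledRow n fun j => X j ω) k‖)]
    exact norm_charFun_spectralDistribution_reverseCirculant_sub_le n _ t
  have hsum := hdiff.add hcos'
  rw [add_zero] at hsum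
  refine hsum.congr fun n => ?_
  simp only [Function.comp_apply]
  ring

end Main

end

theorem mainTheorem5 {Ω : Type*} [MeasurableSpace Ω] (P : Measure Ω) [IsProbabilityMeasure P]
    (X : ℕ → Ω → ℝ) (hmeas : ∀ j, Measurable (X j)) (hindep : iIndepFun X P)
    (hmean : ∀ j, ∫ ω, X j ω ∂P = 0) (hvar : ∀ j, ∫ ω, X j ω ^ 2 ∂P = 1)
    (hint : ∀ j, Integrable (fun ω => |X j ω| ^ 3) P)
    (M : ℝ) (hbound : ∀ j, ∫ ω, |X j ω| ^ 3 ∂P ≤ M) :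
    (∀ᵐ ω ∂P, Tendsto
      (fun n : ℕ => spectralDistribution
        ((√((n + 1 : ℕ) : ℝ))⁻¹ • reverseCirculant (n + 1) (fun j => X j ω))
        (reverseCirculant_isHermitian (n + 1) (fun j => X j ω)))
      atTop (𝓝 symmetrizedRayleigh)) ∧
    (∀ᵐ ω ∂P, Tendsto
      (fun n : ℕ => spectralDistribution
        ((√((n + 1 : ℕ) : ℝ))⁻¹ • symmetricCirculant (n + 1) (fun j => X j ω))
        (symmetricCirculant_isHermitian (n + 1) (fun j => X j ω)))
      atTop (𝓝 standardNormal)) := by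
  have hM0 : 0 < |M| + 1 := by positivity
  have hM : ∀ j, ∫ ω, |X j ω| ^ 3 ∂P ≤ |M| + 1 := fun j =>
    (hbound j).trans ((le_abs_self M).trans (le_add_of_nonneg_right zero_le_one))
  exact ⟨ae_tendsto_spectralDistribution_reverseCirculant hmeas hindep hmean hvar hint hM0 hM,
    ae_tendsto_spectralDistribution_symmetricCirculant hmeas hindep hmean hvar hint hM0 hM⟩
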